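/- **Theorem 5.** Let $d\ge 3$ and $1<k<d$, and put $r=d-k\ge1$, $\tilde r=k-1\ge 1$, so that $d=r+\tilde r+1$. Let $\boldsymbol\xi=(\boldsymbol{x,y,z,\tilde x,\tilde y,\tilde z})$ be $3d-5$ independent formal variables $x_i,y_i$ ($0\le i\le r-1$), $z_i$ ($0\le i\le r-2$), $\tilde x_i,\tilde y_i$ ($0\le i\le\tilde r-1$), $\tilde z_i$ ($0\le i\le \tilde r-2$). The system $$u_i=u_{i-1}-x_{i-1}u_1u_i-y_{i-1}\tilde u_1u_i+z_{i-1}u_{i+1}\quad(1\le i\le r),$$ $$\tilde u_i=\tilde u_{i-1}-\tilde x_{i-1}\tilde u_1\tilde u_i-\tilde y_{i-1}u_1\tilde u_i+\tilde z_{i-1}\tilde u_{i+1}\quad(1\le i\le\tilde r),$$ with $u_0=\tilde u_0=1$ and $z_{r-1}=\tilde z_{\tilde r-1}=0$, has a unique solution $u_1,\dots,u_r,\tilde u_1,\dots,\tilde u_{\tilde r}$ in formal power series in $\boldsymbol\xi$ with complex coefficients; all these series have constant term $1$. Put $s_i=x_iu_1$, $t_i=y_i\tilde u_1$ ($0\le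 i\le r-1$), $w_i=z_iu_{i+2}/u_i$ ($0\le i\le r-2$), $\tilde s_i=\tilde x_i\tilde u_1$, $\tilde t_i=\tilde y_iu_1$ ($0\le i\le\tilde r-1$), $\tilde w_i=\tilde z_i\tilde u_{i+2}/\tilde u_i$ ($0\le i\le\tilde r-2$), and $\boldsymbol\eta=(\boldsymbol{s,t,w,\tilde s,\tilde t,\tilde w})$. For $\boldsymbol\mu\in\mathbb Z^r$, $\boldsymbol{\tilde\mu}\in\mathbb Z^{\tilde r}$ let $$\Phi(\boldsymbol\xi;\boldsymbol\mu,\boldsymbol{\tilde\mu})=\sum_{\boldsymbol q=(\boldsymbol{m,n,p,\tilde m,\tilde n,\tilde p})\ge0}(-1)^{|m|+|n|+|\tilde m|+|\tilde n|}\boldsymbol\xi^{\boldsymbol q}\prod_{j=0}^{r-1}\binom{\mu_j+m_j+n_j+p_{j-1}+p_j-1}{m_j,\,n_j,\,p_j}\prod_{j=0}^{\tilde r-1}\binom{\tilde\mu_j+\tilde m_j+\tilde n_j+\tilde p_{j-1}+\tilde p_j-1}{\tilde m_j,\,\tilde n_j,\,\tilde p_j},$$ where $|m|=\sum_j m_j$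 etc., $p_{-1}=|m|+|\tilde n|$, $\tilde p_{-1}=|\tilde m|+|n|$, $p_{r-1}=\tilde p_{\tilde r-1}=0$, and $\binom{a}{m,n,p}=[x^my^nz^p](1+x+y+z)^a=\frac{a(a-1)\cdots(a-m-n-p+1)}{m!\,n!\,p!}$ for $a\in\mathbb Z$, $m,n,p\ge0$. Then for every $\boldsymbol q'=(\boldsymbol{m',n',p',\tilde m',\tilde n',\tilde p'})\in\mathbb Z^{3d-5}$, as Laurent series in $\boldsymbol\xi$, $$\boldsymbol\eta^{\boldsymbol q'}=\boldsymbol\xi^{\boldsymbol q'}\Bigl(\sum_{i=-1}^{r-1}\sum_{\tilde\iota=-1}^{\tilde r-1}\boldsymbol\xi^{\mathfrak f_i+\tilde{\mathfrak f}_{\tilde\iota}}\Phi(\boldsymbol\xi;\boldsymbol\pi+\boldsymbol\nu^i,\boldsymbol{\tilde\pi}+\boldsymbol{\tilde\nu}^{\tilde\iota})-\sum_{i=0}^{r-1}\sum_{\tilde\iota=0}^{\tilde r-1}\boldsymbol\xi^{\mathfrak g_i+\tilde{\mathfrak g}_{\tilde\iota}}\Phi(\boldsymbol\xi;\boldsymbol\pi+\boldsymbol\nu^i,\boldsymbol{\tilde\pi}+\boldsymbol{\tilde\nu}^{\tilde\iota})\Bigr),$$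 where $\boldsymbol\xi^{\mathfrak f_i}=\prod_{j=0}^{r-1}x_j^{\delta_{ij}}z_j^{\sigma_{ij}}$, $\boldsymbol\xi^{\mathfrak g_i}=\prod_{j=0}^{r-1}y_j^{\delta_{ij}}z_j^{\sigma_{ij}}$ (with $0^0=1$), $\delta_{ij}$ is the Kronecker symbol, $\sigma_{ij}=1$ if $i>j$ and $\sigma_{ij}=0$ if $i\le j$, $\pi_j=p'_{j-1}+p'_j$ and $\nu^i_j=2\sigma_{i,j-1}$ for $0\le j\le r-1$, with $p'_{-1}=|m'|+|\tilde n'|$, $p'_{r-1}=0$; the tilded quantities are defined in the same way with tilded and untilded objects exchanged (so $\tilde p'_{-1}=|\tilde m'|+|n'|$, $\tilde p'_{\tilde r-1}=0$). -/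

import Mathlib

open scoped BigOperators

noncomputable section

namespace JacobiPhi

/-- Index set of the three families of variables on one side: `x_i` and `y_i` for `0 ≤ i < n`,
and `z_i` for `0 ≤ i < n - 1`. -/
abbrev Half (n : ℕ) : Type := Fin n ⊕ (Fin n ⊕ Fin (n - 1))

/-- The index of `x_i`. -/
abbrev ix {n : ℕ} (i : Fin n) : Half n := Sum.inl i

/-- The index of `y_i`. -/
abbrev iy {n : ℕ} (i : Fin n) : Half n := Sum.inr (Sum.inl i)

/-- The index of `z_i`. -/
abbrev iz {n : ℕ} (i : Fin (n - 1)) : Half n := Sum.inr (Sum.inr i)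

/-- Index set of all variables `ξ = (x, y, z, x̃, ỹ, z̃)`: the left summand carries the untilded
variables (`r` of them for `x` and `y`), the right one the tilded ones. For `r, r' ≥ 1` and
`d = r + r' + 1` it has `3 r + 3 r' - 2 = 3 d - 5` elements. -/
abbrev Var (r r' : ℕ) : Type := Half r ⊕ Half r'

/-- Formal power series in the independent variables `ξ`. -/
abbrev PS (r r' : ℕ) : Type := MvPowerSeries (Var r r') ℂ

/-- The field of fractions of the ring of formal power series; it contains the Laurent series
(power series divided by monomials). -/
abbrev Frac (r r' : ℕ) : Type := FractionRing (PS r r')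

/-! ### One side of the system

In this part `ι : Half n → V` places one side inside the set `V` of all variables, so that each
formula also gives its tilded version. -/

/-- `z_j` as a power series, with the convention `z_{n-1} = 0`. -/
def zVar {n : ℕ} {V : Type} (ι : Half n → V) (j : ℕ) : MvPowerSeries V ℂ :=
  if h : j < n - 1 then MvPowerSeries.X (ι (iz ⟨j, h⟩)) else 0

/-- The unknowns `u_1, …, u_n` (given as `u : Fin n → _`) completed by `u_0 = 1`. The value
`u_{n+1} = 0` is only ever multiplied by `z_{n-1} = 0`. -/
def uExt {n : ℕ} {A : Type} [CommRing A] (u : Fin n → A) : ℕ → A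
  | 0 => 1
  | i + 1 => if h : i < n then u ⟨i, h⟩ else 0

/-- The quadratic equations
`u_{j+1} = u_j - x_j u_1 u_{j+1} - y_j ũ_1 u_{j+1} + z_j u_{j+2}`, `0 ≤ j < n`,
of one side; `u` are the unknowns of this side, `u'` those of the other one. -/
def SideEq {n n' : ℕ} {V : Type} (ι : Half n → V)
    (u : Fin n → MvPowerSeries V ℂ) (u' : Fin n' → MvPowerSeries V ℂ) : Prop :=
  ∀ j : Fin n,
    uExt u (j + 1) = uExt u j
      - MvPowerSeries.X (ι (ix j)) * uExt u 1 * uExt u (j + 1)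
      - MvPowerSeries.X (ι (iy j)) * uExt u' 1 * uExt u (j + 1)
      + zVar ι j * uExt u (j + 2)

/-- The new variables of one side:
`s_i = x_i u_1`, `t_i = y_i ũ_1`, `w_i = z_i u_{i+2} / u_i`. -/
def sideEta {n n' : ℕ} {V : Type} (ι : Half n → V)
    (u : Fin n → MvPowerSeries V ℂ) (u' : Fin n' → MvPowerSeries V ℂ) :
    Half n → MvPowerSeries V ℂ
  | Sum.inl i => MvPowerSeries.X (ι (ix i)) * uExt u 1
  | Sum.inr (Sum.inl i) => MvPowerSeries.X (ι (iy i)) * uExt u' 1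
  | Sum.inr (Sum.inr i) =>
      MvPowerSeries.X (ι (iz i)) * uExt u (i + 2) * (uExt u i)⁻¹

/-- For a multi-index `a = (m, n, p)` of one side: `p_j`, with the convention `p_{n-1} = 0`. -/
def pAt {n : ℕ} (a : Half n → ℤ) (j : ℕ) : ℤ :=
  if h : j < n - 1 then a (iz ⟨j, h⟩) else 0

/-- `p_{j-1}`, with the convention `p_{-1} = |m| + |ñ|`; `a = (m, n, p)` is the multi-index
of this side and `b = (m̃, ñ, p̃)` that of the other one. -/
def pPrev {n n' : ℕ} (a : Half n → ℤ) (b : Half n' → ℤ) : ℕ → ℤ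
  | 0 => (∑ i, a (ix i)) + (∑ i, b (iy i))
  | j + 1 => pAt a j

/-- The quadrinomial coefficient `[x^m y^n z^p] (1 + x + y + z)^a`, that is
`a (a - 1) ⋯ (a - m - n - p + 1) / (m! n! p!)`, for `a ∈ ℤ`; it is zero when one of the lower
indices is negative. -/
def quadrinomial (a m n p : ℤ) : ℂ :=
  if 0 ≤ m ∧ 0 ≤ n ∧ 0 ≤ p then
    (∏ k ∈ Finset.range (m + n + p).toNat, ((a : ℂ) - (k : ℂ))) /
      ((m.toNat.factorial : ℂ) * (n.toNat.factorial : ℂ) * (p.toNat.factorial : ℂ))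
  else 0

/-- `∏_{j} binom(μ_j + m_j + n_j + p_{j-1} + p_j - 1; m_j, n_j, p_j)` over one side. -/
def sideCoeff {n n' : ℕ} (μ : Fin n → ℤ) (a : Half n → ℤ) (b : Half n' → ℤ) : ℂ :=
  ∏ j : Fin n,
    quadrinomial (μ j + a (ix j) + a (iy j) + pPrev a b j + pAt a j - 1)
      (a (ix j)) (a (iy j)) (pAt a j)

/-- The Kronecker symbol `δ_{ij}`. -/
def delta (i j : ℤ) : ℕ := if i = j then 1 else 0

/-- The step function: `σ_{ij} = 0` for `i ≤ j` and `σ_{ij} = 1` for `i > j`. -/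
def sigma (i j : ℤ) : ℕ := if i ≤ j then 0 else 1

/-- `ξ^{f_i} = ∏_j x_j^{δ_{ij}} z_j^{σ_{ij}}`. -/
def fMon {n : ℕ} {V : Type} (ι : Half n → V) (i : ℤ) : MvPowerSeries V ℂ :=
  ∏ j : Fin n, MvPowerSeries.X (ι (ix j)) ^ delta i (j : ℕ) * zVar ι j ^ sigma i (j : ℕ)

/-- `ξ^{g_i} = ∏_j y_j^{δ_{ij}} z_j^{σ_{ij}}`. -/
def gMon {n : ℕ} {V : Type} (ι : Half n → V) (i : ℤ) : MvPowerSeries V ℂ :=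
  ∏ j : Fin n, MvPowerSeries.X (ι (iy j)) ^ delta i (j : ℕ) * zVar ι j ^ sigma i (j : ℕ)

/-- `π_j = p'_{j-1} + p'_j`. -/
def piVec {n n' : ℕ} (a : Half n → ℤ) (b : Half n' → ℤ) (j : Fin n) : ℤ :=
  pPrev a b j + pAt a j

/-- `ν^i_j = 2 σ_{i,j-1}`. -/
def nuVec {n : ℕ} (i : ℤ) (j : Fin n) : ℤ := 2 * (sigma i ((j : ℕ) - 1 : ℤ) : ℤ)

/-! ### Both sides together -/

/-- `(u, ũ)` solves the full system of `d - 1 = r + r'` quadratic equations in formal power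
series in `ξ`. (The equations force all constant terms to be `1`.) -/
def IsSolution {r r' : ℕ} (u : Fin r → PS r r') (u' : Fin r' → PS r r') : Prop :=
  SideEq Sum.inl u u' ∧ SideEq Sum.inr u' u

/-- `η = (s, t, w, s̃, t̃, w̃)`. -/
def eta {r r' : ℕ} (u : Fin r → PS r r') (u' : Fin r' → PS r r') : Var r r' → PS r r' :=
  Sum.elim (sideEta Sum.inl u u') (sideEta Sum.inr u' u)

/-- The Laurent monomial `∏_v (F_v)^{q_v}`, `q_v ∈ ℤ`, in power series `F_v`. -/
def laurentMonomial {r r' : ℕ} (F : Var r r' → PS r r') (q : Var r r' → ℤ) : Frac r r' :=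
  ∏ v, (algebraMap (PS r r') (Frac r r') (F v)) ^ q v

/-- The series `Φ(ξ; μ, μ̃)`, given by its coefficients at `ξ^q`, `q = (m, n, p, m̃, ñ, p̃) ≥ 0`. -/
def Phi {r r' : ℕ} (μ : Fin r → ℤ) (μ' : Fin r' → ℤ) : PS r r' := fun q =>
  (-1 : ℂ) ^ ((∑ i, (q (Sum.inl (ix i)) + q (Sum.inl (iy i))))
      + (∑ i, (q (Sum.inr (ix i)) + q (Sum.inr (iy i)))))
    * sideCoeff μ (fun v => (q (Sum.inl v) : ℤ)) (fun v => (q (Sum.inr v) : ℤ))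
    * sideCoeff μ' (fun v => (q (Sum.inr v) : ℤ)) (fun v => (q (Sum.inl v) : ℤ))

/-- `Φ(ξ; π + ν^i, π̃ + ν̃^k)` for the exponent vector `q'`. -/
def shiftedPhi {r r' : ℕ} (q' : Var r r' → ℤ) (i k : ℤ) : PS r r' :=
  Phi (piVec (fun v => q' (Sum.inl v)) (fun v => q' (Sum.inr v)) + nuVec i)
    (piVec (fun v => q' (Sum.inr v)) (fun v => q' (Sum.inl v)) + nuVec k)

end JacobiPhi

end

noncomputable section

namespace JacobiPhi

/-! ### The one-site coefficients -/

/-! The system says (1 + s_j + t_j) u_{j+1} = (1 + w_j) u_j, so in terms of η the ratio u_{j+1}/u_j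
is the explicit unit U_j = (1 + w_j)/(1 + s_j + t_j) (`map_siteUnit_mul`). Hence ξ_v = η_v/ψ_v(η)
with each ψ_v a monomial in the U_j and Ũ_j, and the formula is a multivariate Lagrange inversion.

It is proved without a Jacobian determinant. A linear map R on power series with R(X_v h) = X_v
R(ψ_v h) for all v, h is determined by R(1) (`linearMap_eq_zero_of_X_mul`). Substitution of η has
this property and fixes 1. The map `lagrange` has it too (`lagrange_X_mul`) and sends Laurent
monomials in the U_j, Ũ_j to series Φ (`Phi_eq_lagrange`). So the right-hand side of the formula is
the value at ψ^{q'} of a combination `rhsMap` that has the property as well, and only R(1) = 1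
remains (`rhsMap_one`). Each coefficient of R(1) splits into sums over one side, which telescope
along a chain of sites (`chainSum_proportional`, `side_dichotomy`).

Existence and uniqueness of the solution come from a contraction for the total degree
(`existsUnique_fixedPoint`). -/

/-- The falling product `c (c - 1) ⋯ (c - N + 1)`. -/
def fallProd (c : ℂ) (N : ℕ) : ℂ := ∏ k ∈ Finset.range N, (c - (k : ℂ))

lemma fallProd_succ (c : ℂ) (N : ℕ) : fallProd c (N + 1) = fallProd c N * (c - N) := by
  simp [fallProd, Finset.prod_range_succ]

lemma fallProd_succ' (c : ℂ) (N : ℕ) : fallProd c (N + 1) = c * fallProd (c - 1) N := by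
  rw [fallProd, Finset.prod_range_succ', fallProd, mul_comm]
  congr 1
  · simp
  · refine Finset.prod_congr rfl fun k _ => ?_
    push_cast
    ring

lemma fallProd_diff (c : ℂ) (N : ℕ) :
    fallProd c N - fallProd (c - 1) N = N * fallProd (c - 1) (N - 1) := by
  cases N with
  | zero => simp [fallProd]
  | succ N =>
    rw [fallProd_succ', fallProd_succ, Nat.add_sub_cancel]
    push_cast
    ring

/-- The coefficient of `s^m t^n w^p` in `(1 + w)^(a - 1) (1 + s + t)^(-a)`. -/
def siteCoeff (a m n p : ℤ) : ℂ :=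
  (-1) ^ (m.toNat + n.toNat) * quadrinomial (a + m + n - 1) m n p

lemma siteCoeff_natCast (a : ℤ) (m n p : ℕ) :
    siteCoeff a m n p = (-1) ^ (m + n) * fallProd (a + m + n - 1) (m + n + p) /
      ((m.factorial : ℂ) * n.factorial * p.factorial) := by
  have h : ((m : ℤ) + n + p).toNat = m + n + p := by omega
  simp [siteCoeff, quadrinomial, fallProd, h, mul_div_assoc]

lemma siteCoeff_eq_zero {a m n p : ℤ} (h : m < 0 ∨ n < 0 ∨ p < 0) : siteCoeff a m n p = 0 := by
  rw [siteCoeff, quadrinomial, if_neg (by omega), mul_zero]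

lemma siteCoeff_comm (a m n p : ℤ) : siteCoeff a m n p = siteCoeff a n m p := by
  have h : (m + n + p).toNat = (n + m + p).toNat := by rw [add_comm m n]
  have h2 : a + m + n - 1 = a + n + m - 1 := by ring
  have h3 : (0 ≤ m ∧ 0 ≤ n ∧ 0 ≤ p) ↔ (0 ≤ n ∧ 0 ≤ m ∧ 0 ≤ p) := by tauto
  simp only [siteCoeff, quadrinomial, h, h2, h3, add_comm m.toNat n.toNat,
    mul_comm (m.toNat.factorial : ℂ)]

/-- Raising a while lowering m keeps the top entry a + m + n - 1, so only one factor of the falling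
product is lost. This and the next two lemmas have the same bracket, multiplied by -m, -n and p. If
the lowered index is 0 both sides vanish, so the truncated subtraction is harmless. -/
lemma siteCoeff_pred_left (a : ℤ) (m n p : ℕ) :
    siteCoeff (a + 1) (m - 1) n p =
      -(m : ℂ) * ((-1) ^ (m + n) * fallProd (a + m + n - 1) (m + n + p - 1) /
        ((m.factorial : ℂ) * n.factorial * p.factorial)) := by
  cases m with
  | zero => rw [siteCoeff_eq_zero (by simp)]; simp
  | succ m =>
    have h : ((m + 1 : ℕ) : ℤ) - 1 = m := by push_cast; ring
    have h2 : m + 1 + n + p - 1 = m + n + p := by omega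
    rw [h, siteCoeff_natCast, h2, Nat.factorial_succ]
    have hm : (m : ℂ) + 1 ≠ 0 := Nat.cast_add_one_ne_zero m
    have hc : ((a + 1 : ℤ) : ℂ) + m + n - 1 = a + (m + 1 : ℕ) + n - 1 := by push_cast; ring
    rw [hc]
    have := Nat.factorial_ne_zero m
    have := Nat.factorial_ne_zero n
    have := Nat.factorial_ne_zero p
    push_cast
    field_simp
    ring

lemma siteCoeff_pred_mid (a : ℤ) (m n p : ℕ) :
    siteCoeff (a + 1) m (n - 1) p =
      -(n : ℂ) * ((-1) ^ (m + n) * fallProd (a + m + n - 1) (m + n + p - 1) /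
        ((m.factorial : ℂ) * n.factorial * p.factorial)) := by
  rw [siteCoeff_comm, siteCoeff_pred_left, add_comm n m, add_right_comm (a : ℂ),
    mul_comm (n.factorial : ℂ)]

lemma siteCoeff_pred_right (a : ℤ) (m n p : ℕ) :
    siteCoeff a m n (p - 1) =
      (p : ℂ) * ((-1) ^ (m + n) * fallProd (a + m + n - 1) (m + n + p - 1) /
        ((m.factorial : ℂ) * n.factorial * p.factorial)) := by
  cases p with
  | zero => rw [siteCoeff_eq_zero (by simp)]; simp
  | succ p =>
    have h : ((p + 1 : ℕ) : ℤ) - 1 = p := by push_cast; ring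
    have h2 : m + n + (p + 1) - 1 = m + n + p := by omega
    rw [h, siteCoeff_natCast, h2, Nat.factorial_succ]
    have hm : (p : ℂ) + 1 ≠ 0 := Nat.cast_add_one_ne_zero p
    have := Nat.factorial_ne_zero m
    have := Nat.factorial_ne_zero n
    have := Nat.factorial_ne_zero p
    push_cast
    field_simp

/-- The coefficientwise form of `(1 + s + t) B(a + 1) = (1 + w) B(a)` for
`B(a) = (1 + w)^(a - 1) (1 + s + t)^(-a)`. -/
lemma siteCoeff_recursion (a m n p : ℤ) :
    siteCoeff (a + 1) m n p + siteCoeff (a + 1) (m - 1) n p + siteCoeff (a + 1) m (n - 1) p =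
      siteCoeff a m n p + siteCoeff a m n (p - 1) := by
  by_cases h : m < 0 ∨ n < 0 ∨ p < 0
  · rw [siteCoeff_eq_zero h, siteCoeff_eq_zero h, siteCoeff_eq_zero (by omega),
      siteCoeff_eq_zero (by omega), siteCoeff_eq_zero (by omega)]
    ring
  obtain ⟨m, rfl⟩ := Int.eq_ofNat_of_zero_le (show 0 ≤ m by omega)
  obtain ⟨n, rfl⟩ := Int.eq_ofNat_of_zero_le (show 0 ≤ n by omega)
  obtain ⟨p, rfl⟩ := Int.eq_ofNat_of_zero_le (show 0 ≤ p by omega)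
  rw [siteCoeff_natCast, siteCoeff_natCast, siteCoeff_pred_left, siteCoeff_pred_mid,
    siteCoeff_pred_right]
  have key := fallProd_diff (a + m + n) (m + n + p)
  have hc : ((a + 1 : ℤ) : ℂ) + m + n - 1 = a + m + n := by push_cast; ring
  rw [hc, eq_add_of_sub_eq key]
  push_cast
  ring

/-- Up to a common factor, the coefficients at one site with outgoing index `P = a - p` are the
four indices; the exception is the site at which all indices vanish. -/
lemma siteCoeff_proportional (P : ℤ) (m n p : ℕ) :
    ((P ≠ 0 ∨ m ≠ 0 ∨ n ≠ 0 ∨ p ≠ 0) ∧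
      ∃ E : ℂ, siteCoeff (P + p) m n p = P * E ∧ siteCoeff (P + p) m n (p - 1) = p * E ∧
        siteCoeff (P + p + 1) (m - 1) n p = -m * E ∧
        siteCoeff (P + p + 1) m (n - 1) p = -n * E) ∨
    ((P = 0 ∧ m = 0 ∧ n = 0 ∧ p = 0) ∧ siteCoeff (P + p) m n p = 1 ∧
      siteCoeff (P + p) m n (p - 1) = 0 ∧ siteCoeff (P + p + 1) (m - 1) n p = 0 ∧
      siteCoeff (P + p + 1) m (n - 1) p = 0) := by
  by_cases h : m + n + p = 0
  · obtain ⟨rfl, rfl, rfl⟩ : m = 0 ∧ n = 0 ∧ p = 0 := by omega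
    have h0 : siteCoeff (P + (0 : ℕ)) (0 : ℕ) (0 : ℕ) (0 : ℕ) = 1 := by
      rw [siteCoeff_natCast]; simp [fallProd]
    rw [siteCoeff_pred_left, siteCoeff_pred_mid, siteCoeff_pred_right, h0]
    by_cases hP : P = 0
    · right; simp [hP]
    · left
      refine ⟨Or.inl hP, (P : ℂ)⁻¹, ?_⟩
      have : (P : ℂ) ≠ 0 := by exact_mod_cast hP
      simp [this]
  · left
    refine ⟨by omega, (-1) ^ (m + n) * fallProd ((P + p : ℤ) + m + n - 1) (m + n + p - 1) /
        ((m.factorial : ℂ) * n.factorial * p.factorial), ?_, siteCoeff_pred_right _ _ _ _,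
        siteCoeff_pred_left _ _ _ _, siteCoeff_pred_mid _ _ _ _⟩
    obtain ⟨N, hN⟩ := Nat.exists_eq_succ_of_ne_zero h
    rw [siteCoeff_natCast, hN, fallProd_succ, Nat.succ_sub_one]
    have h2 : (m : ℂ) + n + p = N + 1 := by exact_mod_cast hN
    -- The last factor of the falling product is exactly P.
    have h3 : ((P + p : ℤ) : ℂ) + m + n - 1 - N = P := by
      push_cast; linear_combination h2
    rw [h3]
    ring

/-! ### Chains of sites -/

/-- The sum over the position `i` at which a chain of `n` sites switches from the weights `l`
through `e i` to the weights `g`. -/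
def chainSum (g l e : ℕ → ℂ) (n : ℕ) : ℂ :=
  ∑ i ∈ Finset.range n, (∏ j ∈ Finset.range i, l j) * e i * ∏ j ∈ Finset.Ico (i + 1) n, g j

lemma chainSum_succ (g l e : ℕ → ℂ) (n : ℕ) :
    chainSum g l e (n + 1) = chainSum g l e n * g n + (∏ j ∈ Finset.range n, l j) * e n := by
  rw [chainSum, Finset.sum_range_succ, chainSum, Finset.sum_mul]
  congr 1
  · refine Finset.sum_congr rfl fun i hi => ?_
    rw [Finset.prod_Ico_succ_top (Nat.succ_le_of_lt (Finset.mem_range.1 hi))]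
    ring
  · simp

/-- With site weights q_j E_j, p_j E_j, -m_j E_j, -n_j E_j and q_{j+1} = p_j, a chain switching at i
gives p_0 ⋯ p_{i-1} · (-m_i) · p_i ⋯ p_{N-1} ∏ E_j. This is -m_i D with D = p_0 ⋯ p_{N-1} ∏ E_j
independent of i. The second alternative covers chains whose indices all vanish. -/
lemma chainSum_proportional (P : ℤ) (m n p : ℕ → ℕ) (q : ℕ → ℤ) (hq0 : q 0 = P)
    (hq : ∀ j, q (j + 1) = p j) (g l ex ey : ℕ → ℂ)
    (hg : ∀ j, g j = siteCoeff (q j + p j) (m j) (n j) (p j))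
    (hl : ∀ j, l j = siteCoeff (q j + p j) (m j) (n j) (p j - 1))
    (hex : ∀ j, ex j = siteCoeff (q j + p j + 1) (m j - 1) (n j) (p j))
    (hey : ∀ j, ey j = siteCoeff (q j + p j + 1) (m j) (n j - 1) (p j)) (N : ℕ) :
    (¬ (P = 0 ∧ ∀ j < N + 1, m j = 0 ∧ n j = 0 ∧ p j = 0) ∧
      ∃ D : ℂ, ∏ j ∈ Finset.range (N + 1), g j = P * D ∧
        ∏ j ∈ Finset.range (N + 1), l j = p N * D ∧
        chainSum g l ex (N + 1) = -(∑ j ∈ Finset.range (N + 1), (m j : ℂ)) * D ∧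
        chainSum g l ey (N + 1) = -(∑ j ∈ Finset.range (N + 1), (n j : ℂ)) * D) ∨
    ((P = 0 ∧ ∀ j < N + 1, m j = 0 ∧ n j = 0 ∧ p j = 0) ∧
      ∏ j ∈ Finset.range (N + 1), g j = 1 ∧ ∏ j ∈ Finset.range (N + 1), l j = 0 ∧
      chainSum g l ex (N + 1) = 0 ∧ chainSum g l ey (N + 1) = 0) := by
  induction N with
  | zero =>
    have := siteCoeff_proportional (q 0) (m 0) (n 0) (p 0)
    rw [← hg, ← hl, ← hex, ← hey, hq0] at this
    simp only [chainSum_succ, zero_add, Finset.prod_range_one, Finset.sum_range_one, Nat.lt_one_iff,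
      forall_eq, Finset.prod_range_zero, one_mul]
    simp only [chainSum, Finset.range_zero, Finset.sum_empty, zero_mul, zero_add]
    rcases this with ⟨h, h'⟩ | h
    · exact Or.inl ⟨by omega, h'⟩
    · exact Or.inr h
  | succ N ih =>
    have site := siteCoeff_proportional (q (N + 1)) (m (N + 1)) (n (N + 1)) (p (N + 1))
    rw [← hg, ← hl, ← hex, ← hey, hq] at site
    simp only [chainSum_succ _ _ _ (N + 1), Finset.prod_range_succ _ (N + 1),
      Finset.sum_range_succ _ (N + 1)]
    rcases ih with ⟨h, D, h1, h2, h3, h4⟩ | ⟨⟨hP, h⟩, h1, h2, h3, h4⟩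
    · refine Or.inl ⟨fun h' => h ⟨h'.1, fun j hj => h'.2 j (by omega)⟩, ?_⟩
      rw [h1, h2, h3, h4]
      rcases site with ⟨-, E, e1, e2, e3, e4⟩ | ⟨⟨z1, z2, z3, z4⟩, e1, e2, e3, e4⟩
      · refine ⟨D * E * p N, ?_⟩
        rw [e1, e2, e3, e4]
        push_cast
        exact ⟨by ring, by ring, by ring, by ring⟩
      -- An exceptional site has incoming index p_N = 0 and weights 1, 0, 0, 0, so D is unchanged.
      · refine ⟨D, ?_⟩
        rw [e1, e2, e3, e4, z2, z3, z4]
        simp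
    · rw [h1, h2, h3, h4]
      have hp := (h N (by omega)).2.2
      rcases site with ⟨hne, E, e1, e2, e3, e4⟩ | ⟨⟨z1, z2, z3, z4⟩, e1, e2, e3, e4⟩
      -- After a vanishing chain the incoming index is 0, so g vanishes at the new site. As the
      -- product of the l is already 0, everything is 0 and D = 0 serves.
      · refine Or.inl ⟨fun h' => ?_, 0, ?_⟩
        · have := h'.2 (N + 1) (by omega)
          omega
        · rw [e1, hp]; simp
      · refine Or.inr ⟨⟨hP, fun j hj => ?_⟩, ?_⟩
        · rcases Nat.lt_succ_iff_lt_or_eq.1 hj with hj | rfl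
          · exact h j hj
          · exact ⟨z2, z3, z4⟩
        · rw [e1]; simp

/-! ### Power series given by functions of integer exponents -/

/-- The power series whose coefficients are the values of `F` at nonnegative exponents. -/
def ofInt {V : Type} (F : (V → ℤ) → ℂ) : MvPowerSeries V ℂ := fun q => F (fun v => (q v : ℤ))

lemma coeff_ofInt {V : Type} (F : (V → ℤ) → ℂ) (q : V →₀ ℕ) :
    MvPowerSeries.coeff q (ofInt F) = F (fun v => (q v : ℤ)) := rfl

/-- Since F vanishes off the nonnegative orthant, multiplying by a monomial is a plain shift of
exponents with no case distinction. -/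
lemma monomial_mul_ofInt {V : Type} {F : (V → ℤ) → ℂ} (hF : ∀ x, (∃ v, x v < 0) → F x = 0)
    (e : V →₀ ℕ) :
    MvPowerSeries.monomial e (1 : ℂ) * ofInt F = ofInt fun x => F fun v => x v - e v := by
  classical
  ext q
  rw [MvPowerSeries.coeff_monomial_mul, coeff_ofInt, one_mul]
  split_ifs with h
  · rw [coeff_ofInt]
    congr 1
    ext v
    rw [Finsupp.tsub_apply, Nat.cast_sub (h v)]
  · symm
    apply hF
    simp only [Finsupp.le_def, not_forall, not_le] at h
    obtain ⟨v, hv⟩ := h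
    exact ⟨v, sub_neg.2 (Int.ofNat_lt.2 hv)⟩

lemma X_mul_ofInt {V : Type} [DecidableEq V] {F : (V → ℤ) → ℂ}
    (hF : ∀ x, (∃ v, x v < 0) → F x = 0) (w : V) :
    MvPowerSeries.X w * ofInt F = ofInt fun x => F (x - Pi.single w 1) := by
  rw [MvPowerSeries.X_def, monomial_mul_ofInt hF]
  congr 1
  ext x
  congr 1
  ext v
  rw [Pi.sub_apply, Finsupp.single_apply, Pi.single_apply]
  simp [eq_comm]

/-! ### The units `(1 + w_j) / (1 + s_j + t_j)` and their powers -/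

variable {n n' : ℕ} {V : Type}

/-- The product over one side of the site coefficients. -/
def sideProd (a : Fin n → ℤ) (y : Half n → ℤ) : ℂ :=
  ∏ j : Fin n, siteCoeff (a j) (y (ix j)) (y (iy j)) (pAt y j)

lemma sideProd_eq_zero (a : Fin n → ℤ) {y : Half n → ℤ} (h : ∃ v, y v < 0) :
    sideProd a y = 0 := by
  obtain ⟨i | i | i, hv⟩ := h
  · exact Finset.prod_eq_zero (Finset.mem_univ i) (siteCoeff_eq_zero (Or.inl hv))
  · exact Finset.prod_eq_zero (Finset.mem_univ i) (siteCoeff_eq_zero (Or.inr (Or.inl hv)))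
  · refine Finset.prod_eq_zero (Finset.mem_univ (⟨i, by omega⟩ : Fin n))
      (siteCoeff_eq_zero (Or.inr (Or.inr ?_)))
    simpa [pAt] using hv

lemma sideProd_eq_mul (a a' : Fin n → ℤ) (y y' : Half n → ℤ) (j : Fin n)
    (h : ∀ k, k ≠ j → a' k = a k ∧ y' (ix k) = y (ix k) ∧ y' (iy k) = y (iy k) ∧
      pAt y' k = pAt y k) :
    sideProd a' y' = siteCoeff (a' j) (y' (ix j)) (y' (iy j)) (pAt y' j) *
      ∏ k ∈ Finset.univ.erase j, siteCoeff (a k) (y (ix k)) (y (iy k)) (pAt y k) := by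
  rw [sideProd, ← Finset.mul_prod_erase _ _ (Finset.mem_univ j)]
  congr 1
  refine Finset.prod_congr rfl fun k hk => ?_
  obtain ⟨h1, h2, h3, h4⟩ := h k (Finset.ne_of_mem_erase hk)
  rw [h1, h2, h3, h4]

lemma sideProd_recursion (a : Fin n → ℤ) (y : Half n → ℤ) (j : Fin n) :
    sideProd (a + Pi.single j 1) y + sideProd (a + Pi.single j 1) (y - Pi.single (ix j) 1) +
        sideProd (a + Pi.single j 1) (y - Pi.single (iy j) 1) =
      sideProd a y +
        if h : (j : ℕ) < n - 1 then sideProd a (y - Pi.single (iz ⟨j, h⟩) 1) else 0 := by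
  rw [sideProd_eq_mul a (a + Pi.single j 1) y y j (by simp +contextual),
    sideProd_eq_mul a (a + Pi.single j 1) y (y - Pi.single (ix j) 1) j
      (by simp +contextual [pAt]),
    sideProd_eq_mul a (a + Pi.single j 1) y (y - Pi.single (iy j) 1) j
      (by simp +contextual [pAt]),
    sideProd_eq_mul a a y y j (by simp)]
  have key := siteCoeff_recursion (a j) (y (ix j)) (y (iy j)) (pAt y j)
  split_ifs with h
  · rw [sideProd_eq_mul a a y (y - Pi.single (iz ⟨j, h⟩) 1) j
      (fun k hk => by
        have : (k : ℕ) ≠ j := fun h => hk (Fin.ext h)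
        simp [pAt, this])]
    simp only [pAt, h, dif_pos] at key
    simp [pAt, h, ← add_mul, key]
  -- The last site has no variable w; there p = 0 and the term with p - 1 drops out.
  · have h0 : pAt y j = 0 := dif_neg h
    rw [h0, siteCoeff_eq_zero (p := 0 - 1) (by simp)] at key
    simp only [add_zero] at key
    simp [pAt, h, ← add_mul, key]

/-- The denominator `1 + s_j + t_j`. -/
def siteDen (ι : Half n → V) (j : Fin n) : MvPowerSeries V ℂ :=
  1 + MvPowerSeries.X (ι (ix j)) + MvPowerSeries.X (ι (iy j))

lemma isUnit_siteDen (ι : Half n → V) (j : Fin n) : IsUnit (siteDen ι j) := by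
  simp [MvPowerSeries.isUnit_iff_constantCoeff, siteDen]

lemma constantCoeff_zVar (ι : Half n → V) (j : ℕ) :
    MvPowerSeries.constantCoeff (zVar ι j) = 0 := by
  unfold zVar
  split_ifs <;> simp

lemma isUnit_one_add_zVar (ι : Half n → V) (j : ℕ) : IsUnit (1 + zVar ι j) := by
  simp [MvPowerSeries.isUnit_iff_constantCoeff, constantCoeff_zVar]

/-- The unit `(1 + w_j) / (1 + s_j + t_j)`; it is `1` for `j ≥ n`. -/
def siteUnit (ι : Half n → V) (j : ℕ) : (MvPowerSeries V ℂ)ˣ :=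
  if h : j < n then (isUnit_one_add_zVar ι j).unit * (isUnit_siteDen ι ⟨j, h⟩).unit⁻¹ else 1

lemma siteDen_mul_siteUnit (ι : Half n → V) (j : Fin n) :
    siteDen ι j * siteUnit ι j = 1 + zVar ι j := by
  have h : (isUnit_siteDen ι j).unit * siteUnit ι j = (isUnit_one_add_zVar ι j).unit := by
    rw [siteUnit, dif_pos j.2, mul_comm, inv_mul_cancel_right]
  simpa using congrArg Units.val h

/-- The factor c stands for the other side: by `hc` it ignores the variables of this side, so the
recursion at site j passes to the whole series. -/
lemma ofInt_recursion [DecidableEq V] {ι : Half n → V} (hι : Function.Injective ι)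
    (c : (V → ℤ) → ℂ) (hc : ∀ x v, c (x - Pi.single (ι v) 1) = c x)
    (hz : ∀ (a : Fin n → ℤ) x, (∃ v, x v < 0) → sideProd a (x ∘ ι) * c x = 0)
    (a : Fin n → ℤ) (j : Fin n) :
    ofInt (fun x => sideProd (a + Pi.single j 1) (x ∘ ι) * c x) =
      siteUnit ι j * ofInt (fun x => sideProd a (x ∘ ι) * c x) := by
  refine (isUnit_siteDen ι j).mul_left_cancel ?_
  rw [← mul_assoc, siteDen_mul_siteUnit, siteDen, add_mul, add_mul, add_mul, one_mul, one_mul,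
    X_mul_ofInt (hz _), X_mul_ofInt (hz _)]
  have hcomp : ∀ (x : V → ℤ) v, (x - Pi.single (ι v) 1) ∘ ι = x ∘ ι - Pi.single v 1 := by
    intro x v
    ext w
    simp [Pi.single_apply, hι.eq_iff]
  have hzv : zVar ι j * ofInt (fun x => sideProd a (x ∘ ι) * c x) = ofInt fun x =>
      (if h : (j : ℕ) < n - 1 then sideProd a (x ∘ ι - Pi.single (iz ⟨j, h⟩) 1) else 0) * c x := by
    unfold zVar
    split_ifs with h
    · rw [X_mul_ofInt (hz _)]
      simp only [hcomp, hc]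
    · ext q
      rw [coeff_ofInt, zero_mul, zero_mul, map_zero]
  rw [hzv]
  ext q
  simp only [map_add, coeff_ofInt, hcomp, hc, ← add_mul, sideProd_recursion]

/-- The Laurent monomial with exponents `a` in the units of one side. -/
def sidePow (ι : Half n → V) (a : Fin n → ℤ) : (MvPowerSeries V ℂ)ˣ :=
  ∏ j : Fin n, siteUnit ι j ^ a j

lemma sidePow_add (ι : Half n → V) (a b : Fin n → ℤ) :
    sidePow ι (a + b) = sidePow ι a * sidePow ι b := by
  simp [sidePow, zpow_add, Finset.prod_mul_distrib]

/-- A function on `ℤ^n` with values in a module over a commutative group `G` which each unit step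
multiplies by a fixed element is a Laurent monomial times its value at `0`. -/
lemma eq_prod_zpow_smul {G M : Type} [CommGroup G] [MulAction G M] (g : Fin n → G)
    (f : (Fin n → ℤ) → M) (hf : ∀ a j, f (a + Pi.single j 1) = g j • f a) (a : Fin n → ℤ) :
    f a = (∏ j, g j ^ a j) • f 0 := by
  have step : ∀ (j : Fin n) (k : ℤ) a, f (a + Pi.single j k) = g j ^ k • f a := by
    intro j k
    induction k using Int.induction_on with
    | zero => simp
    | succ k ih =>
      intro a
      rw [Pi.single_add, ← add_assoc, hf, ih, smul_smul, ← zpow_one_add, add_comm]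
    | pred k ih =>
      intro a
      have := hf (a + Pi.single j (-(k : ℤ) - 1)) j
      rw [add_assoc, ← Pi.single_add, sub_add_cancel, ih] at this
      rw [← inv_smul_eq_iff] at this
      rw [← this, smul_smul, zpow_sub_one, mul_comm]
  have main : ∀ s : Finset (Fin n), f (∑ j ∈ s, Pi.single j (a j)) = (∏ j ∈ s, g j ^ a j) • f 0 := by
    intro s
    induction s using Finset.induction_on with
    | empty => simp
    | insert j s hj ih =>
      rw [Finset.sum_insert hj, Finset.prod_insert hj, add_comm, step, ih, smul_smul]
  have := main Finset.univ
  rwa [Finset.univ_sum_single] at this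

/-- The series `∏_j B_j(a_j) ∏_j B̃_j(a'_j)`, `B(a) = (1 + w)^(a - 1) (1 + s + t)^(-a)`. -/
def pairSeries {r r' : ℕ} (a : Fin r → ℤ) (a' : Fin r' → ℤ) : PS r r' :=
  ofInt fun x => sideProd a (x ∘ Sum.inl) * sideProd a' (x ∘ Sum.inr)

lemma sideProd_mul_sideProd_eq_zero {r r' : ℕ} (a : Fin r → ℤ) (a' : Fin r' → ℤ)
    (x : Var r r' → ℤ) (h : ∃ v, x v < 0) :
    sideProd a (x ∘ Sum.inl) * sideProd a' (x ∘ Sum.inr) = 0 := by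
  obtain ⟨v | v, hv⟩ := h
  · rw [sideProd_eq_zero a ⟨v, hv⟩, zero_mul]
  · rw [sideProd_eq_zero a' ⟨v, hv⟩, mul_zero]

/-- Each unit step in an exponent multiplies the series by one U_j or Ũ_j. The base series
`pairSeries 0 0` is never needed in closed form. -/
lemma pairSeries_eq {r r' : ℕ} (a : Fin r → ℤ) (a' : Fin r' → ℤ) :
    pairSeries a a' = ((sidePow Sum.inl a * sidePow Sum.inr a' : (PS r r')ˣ) : PS r r') *
      pairSeries 0 0 := by
  have left : ∀ (a : Fin r → ℤ) (a' : Fin r' → ℤ),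
      pairSeries a a' = sidePow (V := Var r r') Sum.inl a • pairSeries 0 a' := by
    intro a a'
    refine eq_prod_zpow_smul (fun j : Fin r => siteUnit (V := Var r r') Sum.inl j)
      (fun a => pairSeries a a') (fun a j => ?_) a
    rw [Units.smul_def, smul_eq_mul]
    refine ofInt_recursion Sum.inl_injective (fun x => sideProd a' (x ∘ Sum.inr)) (fun x v => ?_)
      (fun a x h => sideProd_mul_sideProd_eq_zero a a' x h) a j
    congr 1
    ext w
    simp
  have right : ∀ a' : Fin r' → ℤ,
      pairSeries (0 : Fin r → ℤ) a' = sidePow (V := Var r r') Sum.inr a' • pairSeries 0 0 := by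
    intro a'
    refine eq_prod_zpow_smul (fun j : Fin r' => siteUnit (V := Var r r') Sum.inr j)
      (fun a' => pairSeries 0 a') (fun a' j => ?_) a'
    rw [Units.smul_def, smul_eq_mul]
    simp only [pairSeries, mul_comm (sideProd (0 : Fin r → ℤ) _)]
    refine ofInt_recursion Sum.inr_injective (fun x => sideProd 0 (x ∘ Sum.inl)) (fun x v => ?_)
      (fun a' x h => ?_) a' j
    · congr 1
      ext w
      simp
    · rw [mul_comm]
      exact sideProd_mul_sideProd_eq_zero 0 a' x h
  rw [left, right, smul_smul, Units.smul_def, smul_eq_mul]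

/-! ### The change of variables `ξ_v = η_v / ψ_v(η)` -/

/-- The units `ψ` of one side: `u_1`, `ũ_1` and `u_{i+2} / u_i` as series in `η`. -/
def sidePsi (ι : Half n → V) (ι' : Half n' → V) : Half n → (MvPowerSeries V ℂ)ˣ
  | Sum.inl _ => siteUnit ι 0
  | Sum.inr (Sum.inl _) => siteUnit ι' 0
  | Sum.inr (Sum.inr i) => siteUnit ι i * siteUnit ι (i + 1)

/-- The units `ψ_v` for which `ξ_v = η_v / ψ_v(η)`. -/
def psi {r r' : ℕ} : Var r r' → (PS r r')ˣ :=
  Sum.elim (sidePsi Sum.inl Sum.inr) (sidePsi Sum.inr Sum.inl)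

/-- In π_j = p_{j-1} + p_j each p_i occurs at the sites i and i + 1, hence as the exponent of U_i
U_{i+1}; p_{-1} occurs only at site 0. -/
lemma sidePow_piVec (hn : 1 ≤ n) (ι : Half n → V) (a : Half n → ℤ) (b : Half n' → ℤ) :
    sidePow ι (piVec a b) = siteUnit ι 0 ^ (∑ i, a (ix i)) * siteUnit ι 0 ^ (∑ i, b (iy i)) *
      ∏ i : Fin (n - 1), (siteUnit ι i * siteUnit ι (i + 1)) ^ a (iz i) := by
  obtain ⟨N, rfl⟩ : ∃ N, n = N + 1 := ⟨n - 1, by omega⟩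
  simp only [sidePow, piVec, zpow_add, Finset.prod_mul_distrib, mul_zpow]
  rw [Fin.prod_univ_succ, Fin.prod_univ_castSucc (fun j : Fin (N + 1) => siteUnit ι j ^ pAt a j)]
  have h1 : ∀ i : Fin N, pAt a (i : ℕ) = a (iz i) := fun i => dif_pos i.2
  have h2 : pAt a N = 0 := dif_neg (by simp)
  simp only [Fin.val_zero, Fin.val_succ, Fin.val_castSucc, Fin.val_last, pPrev, h1, h2, zpow_zero,
    mul_one, zpow_add]
  rw [mul_assoc, mul_comm (∏ i : Fin N, siteUnit ι (i + 1) ^ a (iz i))]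
  rfl

lemma prod_zpow_eq_zpow_sum {I G : Type} [CommGroup G] (s : Finset I) (g : G) (f : I → ℤ) :
    ∏ i ∈ s, g ^ f i = g ^ ∑ i ∈ s, f i := by
  classical
  induction s using Finset.induction_on with
  | empty => simp
  | insert i s hi ih => rw [Finset.prod_insert hi, Finset.sum_insert hi, zpow_add, ih]

lemma prod_sidePsi (ι : Half n → V) (ι' : Half n' → V) (a : Half n → ℤ) :
    ∏ v, sidePsi ι ι' v ^ a v = siteUnit ι 0 ^ (∑ i, a (ix i)) * (siteUnit ι' 0 ^ (∑ i, a (iy i)) *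
      ∏ i : Fin (n - 1), (siteUnit ι i * siteUnit ι (i + 1)) ^ a (iz i)) := by
  simp [Fintype.prod_sum_type, sidePsi, prod_zpow_eq_zpow_sum]

/-- The variables y carry the first unit of the opposite side; exchanging these powers produces
p_{-1} = |m| + |ñ| and its tilded version. -/
lemma prod_psi {r r' : ℕ} (hr : 1 ≤ r) (hr' : 1 ≤ r') (q : Var r r' → ℤ) :
    ∏ v, psi v ^ q v =
      sidePow Sum.inl (piVec (fun v => q (Sum.inl v)) (fun v => q (Sum.inr v))) *
      sidePow Sum.inr (piVec (fun v => q (Sum.inr v)) (fun v => q (Sum.inl v))) := by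
  rw [Fintype.prod_sum_type, sidePow_piVec hr, sidePow_piVec hr']
  simp only [psi, Sum.elim_inl, Sum.elim_inr]
  rw [prod_sidePsi, prod_sidePsi]
  have key : ∀ a b c d z z' : (PS r r')ˣ,
      a * (b * z) * (c * (d * z')) = a * d * z * (c * b * z') := by
    intro a b c d z z'
    simp only [mul_comm, mul_left_comm]
  exact key _ _ _ _ _ _

/-! ### The Lagrange coefficient map and the series Φ -/

/-- The linear map `h ↦ ∑_q ξ^q [η^q] (ψ^q h B)`, where `B` is the series `pairSeries 0 0`. -/
def lagrange (r r' : ℕ) : PS r r' →ₗ[ℂ] PS r r' where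
  toFun h := fun q => MvPowerSeries.coeff q
    (((∏ v, psi v ^ (q v : ℤ) : (PS r r')ˣ) : PS r r') * (h * pairSeries 0 0))
  map_add' f g := by
    funext q
    rw [add_mul, mul_add, map_add]
    rfl
  map_smul' c f := by
    funext q
    rw [smul_mul_assoc, mul_smul_comm, map_smul]
    rfl

lemma coeff_lagrange {r r' : ℕ} (h : PS r r') (q : Var r r' →₀ ℕ) :
    MvPowerSeries.coeff q (lagrange r r' h) = MvPowerSeries.coeff q
      (((∏ v, psi v ^ (q v : ℤ) : (PS r r')ˣ) : PS r r') * (h * pairSeries 0 0)) := rfl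

/-- [η^q] ψ^q η_w h = [η^{q-e}] ψ^{q-e} (ψ_w h) with e the unit vector at w. The same ring serves
for series in η (arguments) and in ξ (values). -/
lemma lagrange_X_mul {r r' : ℕ} (w : Var r r') (h : PS r r') :
    lagrange r r' (MvPowerSeries.X w * h) = MvPowerSeries.X w * lagrange r r' (psi w * h) := by
  ext q
  rw [coeff_lagrange, mul_assoc, mul_left_comm, MvPowerSeries.X_def,
    MvPowerSeries.coeff_monomial_mul, MvPowerSeries.coeff_monomial_mul]
  split_ifs with hq
  · rw [coeff_lagrange, mul_assoc, ← mul_assoc _ (psi w : PS r r'), ← Units.val_mul]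
    congr 4
    obtain ⟨p, rfl⟩ := exists_add_of_le hq
    rw [add_tsub_cancel_left]
    have : ∀ v, psi v ^ (((Finsupp.single w 1 + p : Var r r' →₀ ℕ) v : ℕ) : ℤ) =
        (if v = w then psi v else 1) * psi v ^ (p v : ℤ) := by
      intro v
      rw [Finsupp.add_apply, Finsupp.single_apply]
      split_ifs with h1 h2 h2
      · rw [Nat.cast_add, zpow_add, Nat.cast_one, zpow_one]
      · exact absurd h1.symm h2
      · exact absurd h2.symm h1
      · rw [zero_add, one_mul]
    simp only [this, Finset.prod_mul_distrib]
    rw [Finset.prod_ite_eq' Finset.univ w psi, if_pos (Finset.mem_univ w), mul_comm]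
  · rfl

lemma sideCoeff_eq (μ : Fin n → ℤ) (a : Half n → ℕ) (b : Half n' → ℤ) :
    (-1) ^ (∑ i, (a (ix i) + a (iy i))) * sideCoeff μ (fun v => (a v : ℤ)) b =
      sideProd (μ + piVec (fun v => (a v : ℤ)) b) (fun v => (a v : ℤ)) := by
  rw [← Finset.prod_pow_eq_pow_sum, sideCoeff, ← Finset.prod_mul_distrib, sideProd]
  refine Finset.prod_congr rfl fun j _ => ?_
  simp only [siteCoeff, Int.toNat_natCast, Pi.add_apply, piVec]
  congr 2
  ring

lemma coeff_Phi {r r' : ℕ} (μ : Fin r → ℤ) (μ' : Fin r' → ℤ) (q : Var r r' →₀ ℕ) :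
    MvPowerSeries.coeff q (Phi μ μ') =
      sideProd (μ + piVec (fun v => (q (Sum.inl v) : ℤ)) (fun v => (q (Sum.inr v) : ℤ)))
          (fun v => (q (Sum.inl v) : ℤ)) *
        sideProd (μ' + piVec (fun v => (q (Sum.inr v) : ℤ)) (fun v => (q (Sum.inl v) : ℤ)))
          (fun v => (q (Sum.inr v) : ℤ)) := by
  rw [← sideCoeff_eq μ (fun v => q (Sum.inl v)), ← sideCoeff_eq μ' (fun v => q (Sum.inr v))]
  change (-1 : ℂ) ^ _ * _ * _ = _
  rw [pow_add]
  ring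

/-- Since ψ^q is the monomial in the U_j, Ũ_j with exponents π(q), π̃(q), the coefficient extracted
at q is that of a `pairSeries` with exponents μ + π(q), μ' + π̃(q), a product of site coefficients.
-/
lemma Phi_eq_lagrange {r r' : ℕ} (hr : 1 ≤ r) (hr' : 1 ≤ r') (μ : Fin r → ℤ) (μ' : Fin r' → ℤ) :
    Phi μ μ' =
      lagrange r r' ((sidePow Sum.inl μ * sidePow Sum.inr μ' : (PS r r')ˣ) : PS r r') := by
  ext q
  rw [coeff_lagrange, ← mul_assoc, ← Units.val_mul, prod_psi hr hr', mul_mul_mul_comm,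
    ← sidePow_add, ← sidePow_add, ← pairSeries_eq, pairSeries, coeff_ofInt, coeff_Phi,
    add_comm μ, add_comm μ']
  rfl

/-! ### Linear maps determined by a change of variables -/

lemma exists_eq_C_add_sum_X_mul {V : Type} [Fintype V] (h : MvPowerSeries V ℂ) :
    ∃ g : V → MvPowerSeries V ℂ,
      h = MvPowerSeries.C (MvPowerSeries.constantCoeff h) + ∑ v, MvPowerSeries.X v * g v := by
  classical
  have hex : ∀ d : V →₀ ℕ, ∃ v : Option V, (∀ w, v = some w → d w ≠ 0) ∧ (v = none → d = 0) := by
    intro d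
    by_cases hd : d = 0
    · exact ⟨none, by simp, fun _ => hd⟩
    · obtain ⟨w, hw⟩ := Finsupp.ne_iff.1 hd
      refine ⟨some w, ?_, by simp⟩
      rintro w' h
      obtain rfl := Option.some.inj h
      exact hw
  choose c hc hc' using hex
  -- `c` chooses for each nonzero exponent one variable occurring in it; that term of h is given to
  -- the chosen variable.
  let g : V → MvPowerSeries V ℂ := fun v e =>
    if c (e + Finsupp.single v 1) = some v then
      MvPowerSeries.coeff (e + Finsupp.single v 1) h else 0
  have hg : ∀ v e, MvPowerSeries.coeff e (g v) = if c (e + Finsupp.single v 1) = some v then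
      MvPowerSeries.coeff (e + Finsupp.single v 1) h else 0 := fun _ _ => rfl
  refine ⟨g, ?_⟩
  ext d
  have hterm : ∀ v, MvPowerSeries.coeff d (MvPowerSeries.X v * g v) =
      if c d = some v then MvPowerSeries.coeff d h else 0 := by
    intro v
    rw [MvPowerSeries.X_def, MvPowerSeries.coeff_monomial_mul, one_mul]
    split_ifs with h1 h2 h2
    · rw [hg, tsub_add_cancel_of_le h1, if_pos h2]
    · rw [hg, tsub_add_cancel_of_le h1, if_neg h2]
    · have := hc d v h2
      rw [Finsupp.single_le_iff] at h1
      omega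
    · rfl
  rw [map_add, map_sum, MvPowerSeries.coeff_C]
  simp only [hterm]
  cases hcd : c d with
  | none => simp [hc' d hcd]
  | some v =>
    have : d ≠ 0 := fun h0 => hc d v hcd (by simp [h0])
    simp [this]

/-- A linear map with `Δ(1) = 0` and `Δ(X_v h) = X_v Δ(ψ_v h)` vanishes. -/
lemma linearMap_eq_zero_of_X_mul {V : Type} [Fintype V]
    (Δ : MvPowerSeries V ℂ →ₗ[ℂ] MvPowerSeries V ℂ) (ψ : V → MvPowerSeries V ℂ) (h1 : Δ 1 = 0)
    (hX : ∀ v h, Δ (MvPowerSeries.X v * h) = MvPowerSeries.X v * Δ (ψ v * h)) : Δ = 0 := by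
  classical
  -- The induction is on the degree of the extracted coefficient, for all h at once, because the
  -- rule replaces h by ψ_v times a quotient.
  have main : ∀ N (d : V →₀ ℕ), d.degree = N → ∀ h, MvPowerSeries.coeff d (Δ h) = 0 := by
    intro N
    induction N using Nat.strong_induction_on with
    | _ N ih =>
    intro d hd h
    obtain ⟨g, hg⟩ := exists_eq_C_add_sum_X_mul h
    have hC : Δ (MvPowerSeries.C (MvPowerSeries.constantCoeff h)) = 0 := by
      have : (MvPowerSeries.C (MvPowerSeries.constantCoeff h) : MvPowerSeries V ℂ) =
          MvPowerSeries.constantCoeff h • 1 := by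
        rw [MvPowerSeries.smul_eq_C_mul, mul_one]
      rw [this, map_smul, h1, smul_zero]
    rw [hg, map_add, hC, zero_add, map_sum, map_sum]
    refine Finset.sum_eq_zero fun v _ => ?_
    rw [hX, MvPowerSeries.X_def, MvPowerSeries.coeff_monomial_mul, one_mul]
    split_ifs with hv
    · refine ih (d - Finsupp.single v 1).degree ?_ _ rfl _
      obtain ⟨e, rfl⟩ := exists_add_of_le hv
      rw [← hd, add_tsub_cancel_left, map_add, Finsupp.degree_single]
      omega
    · rfl
  ext h d
  exact main _ d rfl h

/-! ### The sum over the switching positions at one side -/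

/-- The factor of one side in the coefficient of `ξ^{f_i + f̃_k} Φ(ξ; ν^i, ν̃^k)`. -/
def fCoeff (a : Half n → ℤ) (b : Half n' → ℤ) (i : ℤ) : ℂ :=
  ∏ j : Fin n, siteCoeff (pPrev a b j + pAt a j + delta i (j : ℕ)) (a (ix j) - delta i (j : ℕ))
    (a (iy j)) (pAt a j - sigma i (j : ℕ))

/-- The factor of one side in the coefficient of `ξ^{g_i + g̃_k} Φ(ξ; ν^i, ν̃^k)`. -/
def gCoeff (a : Half n → ℤ) (b : Half n' → ℤ) (i : ℤ) : ℂ :=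
  ∏ j : Fin n, siteCoeff (pPrev a b j + pAt a j + delta i (j : ℕ)) (a (ix j))
    (a (iy j) - delta i (j : ℕ)) (pAt a j - sigma i (j : ℕ))

/-- The monomial lowers π_j by σ_{i,j-1} + σ_{ij}, and ν^i_j = 2σ_{i,j-1} leaves the net shift
σ_{i,j-1} - σ_{ij} = δ_{ij}. So only the switching site has a raised exponent. -/
lemma sideProd_shift (a y : Half n → ℤ) (b c : Half n' → ℤ) (i : ℤ) (hi : i ≤ (n : ℤ) - 1)
    (hz : ∀ j, y (iz j) = a (iz j) - sigma i (j : ℕ))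
    (h0 : pPrev y c 0 = pPrev a b 0 - sigma i (-1)) :
    sideProd (nuVec i + piVec y c) y =
      ∏ j : Fin n, siteCoeff (pPrev a b j + pAt a j + delta i (j : ℕ)) (y (ix j)) (y (iy j))
        (pAt a j - sigma i (j : ℕ)) := by
  have hp : ∀ j : ℕ, pAt y j = pAt a j - sigma i j := by
    intro j
    unfold pAt
    split_ifs with h
    · exact hz ⟨j, h⟩
    · have : i ≤ j := by omega
      simp [sigma, this]
  have hpp : ∀ j : ℕ, pPrev y c j = pPrev a b j - sigma i ((j : ℤ) - 1) := by
    intro j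
    cases j with
    | zero => simpa using h0
    | succ j => simp [pPrev, hp]
  refine Finset.prod_congr rfl fun j _ => ?_
  rw [hp, Pi.add_apply, piVec, nuVec, hp, hpp]
  congr 1
  have : (sigma i ((j : ℕ) - 1 : ℤ) : ℤ) = sigma i (j : ℕ) + delta i (j : ℕ) := by
    unfold sigma delta
    split_ifs <;> omega
  rw [this]
  ring

lemma prod_switch (l e g : ℕ → ℂ) {i : ℕ} (hi : i < n) :
    ∏ j : Fin n, (if (j : ℕ) < i then l j else if (j : ℕ) = i then e j else g j) =
      (∏ j ∈ Finset.range i, l j) * e i * ∏ j ∈ Finset.Ico (i + 1) n, g j := by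
  rw [Fin.prod_univ_eq_prod_range (fun j => if j < i then l j else if j = i then e j else g j),
    ← Finset.prod_range_mul_prod_Ico _ hi.le, Finset.prod_eq_prod_Ico_succ_bot hi, mul_assoc]
  congr 1
  · exact Finset.prod_congr rfl fun j hj => if_pos (Finset.mem_range.1 hj)
  · congr 1
    · simp
    · refine Finset.prod_congr rfl fun j hj => ?_
      have := (Finset.mem_Ico.1 hj).1
      rw [if_neg (by omega), if_neg (by omega)]

lemma sum_Icc_zero (t : ℤ → ℂ) (n : ℕ) :
    ∑ i ∈ Finset.Icc (0 : ℤ) ((n : ℤ) - 1), t i = ∑ i ∈ Finset.range n, t i := by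
  symm
  refine Finset.sum_nbij (fun i : ℕ => (i : ℤ)) (fun i hi => ?_) (fun i _ j _ h => ?_)
    (fun i hi => ?_) (fun _ _ => rfl)
  · simp at hi ⊢; omega
  · exact Nat.cast_injective (R := ℤ) h
  · simp at hi ⊢
    exact ⟨i.toNat, by omega, by omega⟩

lemma sum_Icc_neg_one (t : ℤ → ℂ) (n : ℕ) :
    ∑ i ∈ Finset.Icc (-1 : ℤ) ((n : ℤ) - 1), t i = t (-1) + ∑ i ∈ Finset.range n, t i := by
  rw [← sum_Icc_zero, ← Finset.sum_insert (a := (-1 : ℤ)) (by simp)]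
  congr 1
  ext i
  simp
  omega

/-- The term i = -1 contributes (|m| + |ñ|) D and the switching terms -|m| D, which leaves |ñ| D;
the terms with g give -|n| D. -/
lemma side_dichotomy (hn : 1 ≤ n) (a : Half n → ℕ) (b : Half n' → ℕ) :
    (¬ ((∑ i, b (iy i) = 0) ∧ a = 0) ∧ ∃ D : ℂ,
      ∑ i ∈ Finset.Icc (-1 : ℤ) ((n : ℤ) - 1), fCoeff (fun v => (a v : ℤ)) (fun v => (b v : ℤ)) i =
        (∑ i, b (iy i) : ℕ) * D ∧
      ∑ i ∈ Finset.Icc (0 : ℤ) ((n : ℤ) - 1), gCoeff (fun v => (a v : ℤ)) (fun v => (b v : ℤ)) i =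
        -(∑ i, a (iy i) : ℕ) * D) ∨
    (((∑ i, b (iy i) = 0) ∧ a = 0) ∧
      ∑ i ∈ Finset.Icc (-1 : ℤ) ((n : ℤ) - 1),
        fCoeff (fun v => (a v : ℤ)) (fun v => (b v : ℤ)) i = 1 ∧
      ∑ i ∈ Finset.Icc (0 : ℤ) ((n : ℤ) - 1),
        gCoeff (fun v => (a v : ℤ)) (fun v => (b v : ℤ)) i = 0) := by
  obtain ⟨N, rfl⟩ : ∃ N, n = N + 1 := ⟨n - 1, by omega⟩
  let mm : ℕ → ℕ := fun j => if h : j < N + 1 then a (ix ⟨j, h⟩) else 0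
  let nn : ℕ → ℕ := fun j => if h : j < N + 1 then a (iy ⟨j, h⟩) else 0
  let pp : ℕ → ℕ := fun j => if h : j < N then a (iz (n := N + 1) ⟨j, h⟩) else 0
  let P : ℤ := pPrev (fun v => (a v : ℤ)) (fun v => (b v : ℤ)) 0
  let q : ℕ → ℤ := pPrev (fun v => (a v : ℤ)) (fun v => (b v : ℤ))
  have hm : ∀ j : Fin (N + 1), mm j = a (ix j) := fun j => dif_pos j.2
  have hn : ∀ j : Fin (N + 1), nn j = a (iy j) := fun j => dif_pos j.2
  have hp : ∀ j : ℕ, (pp j : ℤ) = pAt (fun v => (a v : ℤ)) j := by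
    intro j
    simp only [pp, pAt, Nat.add_sub_cancel]
    split_ifs <;> rfl
  have hq : ∀ j, q (j + 1) = pp j := fun j => (hp j).symm
  have hP : P = ∑ i, a (ix i) + ∑ i, b (iy i) := by simp [P, pPrev]
  let g : ℕ → ℂ := fun j => siteCoeff (q j + pp j) (mm j) (nn j) (pp j)
  let l : ℕ → ℂ := fun j => siteCoeff (q j + pp j) (mm j) (nn j) (pp j - 1)
  let ex : ℕ → ℂ := fun j => siteCoeff (q j + pp j + 1) (mm j - 1) (nn j) (pp j)
  let ey : ℕ → ℂ := fun j => siteCoeff (q j + pp j + 1) (mm j) (nn j - 1) (pp j)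
  have key := chainSum_proportional P mm nn pp q rfl hq g l ex ey (fun _ => rfl) (fun _ => rfl)
    (fun _ => rfl) (fun _ => rfl) N
  have hf : ∑ i ∈ Finset.Icc (-1 : ℤ) (((N + 1 : ℕ) : ℤ) - 1),
      fCoeff (fun v => (a v : ℤ)) (fun v => (b v : ℤ)) i =
      ∏ j ∈ Finset.range (N + 1), g j + chainSum g l ex (N + 1) := by
    rw [sum_Icc_neg_one, chainSum]
    congr 1
    · rw [← Fin.prod_univ_eq_prod_range, fCoeff]
      refine Finset.prod_congr rfl fun j _ => ?_
      have h1 : delta (-1) (j : ℕ) = 0 := if_neg (by omega)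
      have h2 : sigma (-1) (j : ℕ) = 0 := if_pos (by omega)
      simp [h1, h2, g, hm, hn, hp, q]
    · refine Finset.sum_congr rfl fun i hi => ?_
      rw [← prod_switch l ex g (Finset.mem_range.1 hi), fCoeff]
      refine Finset.prod_congr rfl fun j _ => ?_
      simp only [delta, sigma, Nat.cast_le, Nat.cast_inj]
      -- Sites before i have p lowered (weight `l`), site i has m lowered (`ex`), later sites are
      -- unchanged (`g`).
      rcases lt_trichotomy (j : ℕ) i with h | h | h
      · simp [h, h.ne', h.not_ge, l, hm, hn, hp, q]
      · subst h
        simp [ex, hm, hn, hp, q]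
      · simp [h.le, h.ne, h.ne', h.not_gt, g, hm, hn, hp, q]
  have hg : ∑ i ∈ Finset.Icc (0 : ℤ) (((N + 1 : ℕ) : ℤ) - 1),
      gCoeff (fun v => (a v : ℤ)) (fun v => (b v : ℤ)) i = chainSum g l ey (N + 1) := by
    rw [sum_Icc_zero, chainSum]
    refine Finset.sum_congr rfl fun i hi => ?_
    rw [← prod_switch l ey g (Finset.mem_range.1 hi), gCoeff]
    refine Finset.prod_congr rfl fun j _ => ?_
    simp only [delta, sigma, Nat.cast_le, Nat.cast_inj]
    rcases lt_trichotomy (j : ℕ) i with h | h | h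
    · simp [h, h.ne', h.not_ge, l, hm, hn, hp, q]
    · subst h
      simp [ey, hm, hn, hp, q]
    · simp [h.le, h.ne, h.ne', h.not_gt, g, hm, hn, hp, q]
  have hzero : (P = 0 ∧ ∀ j < N + 1, mm j = 0 ∧ nn j = 0 ∧ pp j = 0) ↔
      ((∑ i, b (iy i) = 0) ∧ a = 0) := by
    constructor
    · rintro ⟨h1, h2⟩
      refine ⟨by omega, ?_⟩
      funext v
      rcases v with j | j | j
      · exact (hm j).symm.trans (h2 j j.2).1
      · exact (hn j).symm.trans (h2 j j.2).2.1
      · have h3 : pp j = a (iz j) := dif_pos (show (j : ℕ) < N from j.2)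
        have : (j : ℕ) < N := j.2
        exact h3.symm.trans (h2 j (by omega)).2.2
    · rintro ⟨h1, rfl⟩
      refine ⟨by rw [hP, h1]; simp, fun j _ => ?_⟩
      simp [mm, nn, pp]
  have hsm : ∑ j ∈ Finset.range (N + 1), (mm j : ℂ) = ∑ i, (a (ix i) : ℂ) := by
    rw [← Fin.sum_univ_eq_sum_range (fun j => (mm j : ℂ))]
    simp only [hm]
  have hsn : ∑ j ∈ Finset.range (N + 1), (nn j : ℂ) = ∑ i, (a (iy i) : ℂ) := by
    rw [← Fin.sum_univ_eq_sum_range (fun j => (nn j : ℂ))]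
    simp only [hn]
  rw [hf, hg, ← hzero]
  refine key.imp (fun ⟨h, D, h1, h2, h3, h4⟩ => ⟨h, D, ?_, ?_⟩)
    (fun ⟨h, h1, h2, h3, h4⟩ => ⟨h, ?_, h4⟩)
  · rw [h1, h3, hsm, hP]
    push_cast
    ring
  · rw [h4, hsn]
    push_cast
    ring
  · rw [h1, h3, add_zero]

/-! ### The right-hand side as a linear map -/

variable {r r' : ℕ}

/-- The exponents of `ξ^{f_i}`. -/
def fExp (i : ℤ) : Half n → ℕ
  | Sum.inl j => delta i (j : ℕ)
  | Sum.inr (Sum.inl _) => 0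
  | Sum.inr (Sum.inr j) => sigma i (j : ℕ)

/-- The exponents of `ξ^{g_i}`. -/
def gExp (i : ℤ) : Half n → ℕ
  | Sum.inl _ => 0
  | Sum.inr (Sum.inl j) => delta i (j : ℕ)
  | Sum.inr (Sum.inr j) => sigma i (j : ℕ)

/-- The factor z_{n-1} = 0 has exponent σ_{i,n-1} = 0 for i ≤ n - 1, so the convention 0^0 = 1
removes it. -/
lemma prod_zVar_pow (ι : Half n → V) {i : ℤ} (hi : i ≤ (n : ℤ) - 1) :
    ∏ j : Fin n, zVar ι j ^ sigma i (j : ℕ) =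
      ∏ j : Fin (n - 1), MvPowerSeries.X (ι (iz j)) ^ sigma i (j : ℕ) := by
  cases n with
  | zero => rfl
  | succ N =>
    have h : sigma i (N : ℕ) = 0 := if_pos (by push_cast at hi; omega)
    rw [Fin.prod_univ_castSucc]
    simp only [Fin.val_castSucc, Fin.val_last, h, pow_zero, mul_one]
    refine Finset.prod_congr rfl fun j _ => ?_
    rw [zVar, dif_pos (show (j : ℕ) < N + 1 - 1 from j.2)]
    rfl

lemma fMon_eq (ι : Half n → V) {i : ℤ} (hi : i ≤ (n : ℤ) - 1) :
    fMon ι i = ∏ v, MvPowerSeries.X (ι v) ^ fExp i v := by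
  rw [fMon, Finset.prod_mul_distrib, prod_zVar_pow ι hi]
  simp [Fintype.prod_sum_type, fExp]

lemma gMon_eq (ι : Half n → V) {i : ℤ} (hi : i ≤ (n : ℤ) - 1) :
    gMon ι i = ∏ v, MvPowerSeries.X (ι v) ^ gExp i v := by
  rw [gMon, Finset.prod_mul_distrib, prod_zVar_pow ι hi]
  simp [Fintype.prod_sum_type, gExp]

lemma Phi_eq_ofInt (μ : Fin r → ℤ) (μ' : Fin r' → ℤ) :
    Phi μ μ' = ofInt fun x =>
      sideProd (μ + piVec (fun v => x (Sum.inl v)) (fun v => x (Sum.inr v)))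
          (fun v => x (Sum.inl v)) *
        sideProd (μ' + piVec (fun v => x (Sum.inr v)) (fun v => x (Sum.inl v)))
          (fun v => x (Sum.inr v)) := by
  ext q
  exact coeff_Phi μ μ' q

lemma prod_X_pow_eq_monomial [Fintype V] (e : V → ℕ) :
    ∏ v, MvPowerSeries.X v ^ e v =
      (MvPowerSeries.monomial (Finsupp.equivFunOnFinite.symm e) 1 : MvPowerSeries V ℂ) := by
  rw [MvPowerSeries.monomial_eq', map_one, one_mul, Finsupp.prod_fintype _ _ (by simp)]
  rfl

lemma coeff_prod_X_pow_mul_Phi (e : Half r → ℕ) (e' : Half r' → ℕ) (μ : Fin r → ℤ)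
    (μ' : Fin r' → ℤ) (q : Var r r' →₀ ℕ) :
    MvPowerSeries.coeff q ((∏ v, MvPowerSeries.X (Sum.inl v) ^ e v) *
        (∏ v, MvPowerSeries.X (Sum.inr v) ^ e' v) * Phi μ μ') =
      sideProd (μ + piVec (fun v => (q (Sum.inl v) : ℤ) - e v) (fun v => (q (Sum.inr v) : ℤ) - e' v))
          (fun v => (q (Sum.inl v) : ℤ) - e v) *
        sideProd
          (μ' + piVec (fun v => (q (Sum.inr v) : ℤ) - e' v) (fun v => (q (Sum.inl v) : ℤ) - e v))
          (fun v => (q (Sum.inr v) : ℤ) - e' v) := by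
  have h := prod_X_pow_eq_monomial (Sum.elim e e')
  rw [Fintype.prod_sum_type] at h
  simp only [Sum.elim_inl, Sum.elim_inr] at h
  rw [h, Phi_eq_ofInt, monomial_mul_ofInt, coeff_ofInt]
  · rfl
  · rintro x ⟨v | v, hv⟩
    · rw [sideProd_eq_zero _ ⟨v, hv⟩, zero_mul]
    · rw [sideProd_eq_zero (y := fun v => x (Sum.inr v)) _ ⟨v, hv⟩, mul_zero]

lemma sum_delta {i : ℤ} (hi : -1 ≤ i) (hi' : i ≤ (n : ℤ) - 1) :
    ∑ j : Fin n, (delta i (j : ℕ) : ℤ) = sigma i (-1) := by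
  rcases hi.eq_or_lt with rfl | hi
  · refine Finset.sum_eq_zero fun j _ => ?_
    rw [delta, if_neg (by omega), Nat.cast_zero]
  · have : sigma i (-1) = 1 := if_neg (by omega)
    rw [this, Finset.sum_eq_single (⟨i.toNat, by omega⟩ : Fin n)]
    · rw [delta, if_pos (by simp; omega)]
    · intro j _ hj
      rw [delta, if_neg, Nat.cast_zero]
      rintro rfl
      exact hj (Fin.ext (by simp))
    · simp

lemma sideProd_fExp (a : Half n → ℤ) (b : Half n' → ℤ) {i : ℤ} (hi : -1 ≤ i)
    (hi' : i ≤ (n : ℤ) - 1) (k : ℤ) :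
    sideProd (nuVec i + piVec (fun v => a v - fExp i v) (fun v => b v - fExp k v))
      (fun v => a v - fExp i v) = fCoeff a b i := by
  rw [sideProd_shift a _ b _ i hi' (fun j => rfl)]
  · simp [fCoeff, fExp]
  · rw [← sum_delta hi hi']
    simp only [pPrev, fExp, Finset.sum_sub_distrib]
    simp
    ring

/-- Here p_{-1} is lowered through ñ, that is, by the monomial of the other side. The loss depends
on k rather than i, and both equal 1 because i, k ≥ 0. -/
lemma sideProd_gExp (a : Half n → ℤ) (b : Half n' → ℤ) {i k : ℤ} (hi : 0 ≤ i)
    (hi' : i ≤ (n : ℤ) - 1) (hk : 0 ≤ k) (hk' : k ≤ (n' : ℤ) - 1) :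
    sideProd (nuVec i + piVec (fun v => a v - gExp i v) (fun v => b v - gExp k v))
      (fun v => a v - gExp i v) = gCoeff a b i := by
  rw [sideProd_shift a _ b _ i hi' (fun j => rfl)]
  · simp [gCoeff, gExp]
  · have h : sigma i (-1) = sigma k (-1) := by
      rw [sigma, sigma, if_neg (by omega), if_neg (by omega)]
    rw [h, ← sum_delta (by omega) hk']
    simp only [pPrev, gExp, Finset.sum_sub_distrib]
    simp
    ring

/-- The linear map which sends a series `h` in `η` to the sum over the switching positions. -/
def rhsMap (r r' : ℕ) : PS r r' →ₗ[ℂ] PS r r' :=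
  (∑ i ∈ Finset.Icc (-1 : ℤ) ((r : ℤ) - 1), ∑ k ∈ Finset.Icc (-1 : ℤ) ((r' : ℤ) - 1),
    LinearMap.mulLeft ℂ (fMon Sum.inl i * fMon Sum.inr k) ∘ₗ lagrange r r' ∘ₗ LinearMap.mulLeft ℂ
      ((sidePow Sum.inl (nuVec i) * sidePow Sum.inr (nuVec k) : (PS r r')ˣ) : PS r r')) -
  ∑ i ∈ Finset.Icc (0 : ℤ) ((r : ℤ) - 1), ∑ k ∈ Finset.Icc (0 : ℤ) ((r' : ℤ) - 1),
    LinearMap.mulLeft ℂ (gMon Sum.inl i * gMon Sum.inr k) ∘ₗ lagrange r r' ∘ₗ LinearMap.mulLeft ℂ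
      ((sidePow Sum.inl (nuVec i) * sidePow Sum.inr (nuVec k) : (PS r r')ˣ) : PS r r')

lemma rhsMap_apply (h : PS r r') :
    rhsMap r r' h =
      (∑ i ∈ Finset.Icc (-1 : ℤ) ((r : ℤ) - 1), ∑ k ∈ Finset.Icc (-1 : ℤ) ((r' : ℤ) - 1),
        fMon Sum.inl i * fMon Sum.inr k * lagrange r r'
          (((sidePow Sum.inl (nuVec i) * sidePow Sum.inr (nuVec k) : (PS r r')ˣ) : PS r r') * h)) -
      ∑ i ∈ Finset.Icc (0 : ℤ) ((r : ℤ) - 1), ∑ k ∈ Finset.Icc (0 : ℤ) ((r' : ℤ) - 1),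
        gMon Sum.inl i * gMon Sum.inr k * lagrange r r'
          (((sidePow Sum.inl (nuVec i) * sidePow Sum.inr (nuVec k) : (PS r r')ˣ) : PS r r') * h) := by
  simp only [rhsMap, LinearMap.sub_apply, LinearMap.sum_apply, LinearMap.comp_apply,
    LinearMap.mulLeft_apply]

lemma rhsMap_X_mul (v : Var r r') (h : PS r r') :
    rhsMap r r' (MvPowerSeries.X v * h) = MvPowerSeries.X v * rhsMap r r' (psi v * h) := by
  rw [rhsMap_apply, rhsMap_apply, mul_sub]
  rw [Finset.mul_sum, Finset.mul_sum]
  refine congrArg₂ (fun f g => f - g) ?_ ?_ <;>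
  · refine Finset.sum_congr rfl fun i _ => ?_
    rw [Finset.mul_sum]
    refine Finset.sum_congr rfl fun k _ => ?_
    rw [mul_left_comm _ (MvPowerSeries.X v), lagrange_X_mul, mul_left_comm _ (MvPowerSeries.X v),
      mul_left_comm (psi v : PS r r')]

lemma rhsMap_sidePow (hr : 1 ≤ r) (hr' : 1 ≤ r') (μ : Fin r → ℤ) (μ' : Fin r' → ℤ) :
    rhsMap r r' ((sidePow Sum.inl μ * sidePow Sum.inr μ' : (PS r r')ˣ) : PS r r') =
      (∑ i ∈ Finset.Icc (-1 : ℤ) ((r : ℤ) - 1), ∑ k ∈ Finset.Icc (-1 : ℤ) ((r' : ℤ) - 1),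
        fMon Sum.inl i * fMon Sum.inr k * Phi (μ + nuVec i) (μ' + nuVec k)) -
      ∑ i ∈ Finset.Icc (0 : ℤ) ((r : ℤ) - 1), ∑ k ∈ Finset.Icc (0 : ℤ) ((r' : ℤ) - 1),
        gMon Sum.inl i * gMon Sum.inr k * Phi (μ + nuVec i) (μ' + nuVec k) := by
  rw [rhsMap_apply]
  simp only [Phi_eq_lagrange hr hr', ← Units.val_mul]
  have key : ∀ i k, (sidePow Sum.inl (nuVec i) * sidePow Sum.inr (nuVec k) : (PS r r')ˣ) *
      (sidePow Sum.inl μ * sidePow Sum.inr μ') =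
      sidePow Sum.inl (μ + nuVec i) * sidePow Sum.inr (μ' + nuVec k) := by
    intro i k
    rw [mul_mul_mul_comm, ← sidePow_add, ← sidePow_add, add_comm μ, add_comm μ']
  simp only [key]

/-- At q ≠ 0 the two sides give |ñ|D · |n|D̃ - (-|n|D)(-|ñ|D̃) = 0. If just one side is exceptional,
its vanishing indices kill the f-sum of the other side, and its own g-sum is 0. At q = 0 the value
is 1. -/
lemma rhsMap_one (hr : 1 ≤ r) (hr' : 1 ≤ r') : rhsMap r r' 1 = 1 := by
  have h0 : (1 : PS r r') = ((sidePow Sum.inl (0 : Fin r → ℤ) *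
      sidePow Sum.inr (0 : Fin r' → ℤ) : (PS r r')ˣ) : PS r r') := by simp [sidePow]
  rw [h0, rhsMap_sidePow hr hr', ← h0]
  simp only [zero_add]
  ext q
  let a : Half r → ℕ := fun v => q (Sum.inl v)
  let b : Half r' → ℕ := fun v => q (Sum.inr v)
  have hf : ∀ i ∈ Finset.Icc (-1 : ℤ) ((r : ℤ) - 1), ∀ k ∈ Finset.Icc (-1 : ℤ) ((r' : ℤ) - 1),
      MvPowerSeries.coeff q (fMon Sum.inl i * fMon Sum.inr k * Phi (nuVec i) (nuVec k) : PS r r') =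
        fCoeff (fun v => (a v : ℤ)) (fun v => (b v : ℤ)) i *
          fCoeff (fun v => (b v : ℤ)) (fun v => (a v : ℤ)) k := by
    intro i hi k hk
    rw [Finset.mem_Icc] at hi hk
    rw [fMon_eq _ hi.2, fMon_eq _ hk.2, coeff_prod_X_pow_mul_Phi,
      ← sideProd_fExp _ _ hi.1 hi.2 k, ← sideProd_fExp _ _ hk.1 hk.2 i]
  have hg : ∀ i ∈ Finset.Icc (0 : ℤ) ((r : ℤ) - 1), ∀ k ∈ Finset.Icc (0 : ℤ) ((r' : ℤ) - 1),
      MvPowerSeries.coeff q (gMon Sum.inl i * gMon Sum.inr k * Phi (nuVec i) (nuVec k) : PS r r') =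
        gCoeff (fun v => (a v : ℤ)) (fun v => (b v : ℤ)) i *
          gCoeff (fun v => (b v : ℤ)) (fun v => (a v : ℤ)) k := by
    intro i hi k hk
    rw [Finset.mem_Icc] at hi hk
    rw [gMon_eq _ hi.2, gMon_eq _ hk.2, coeff_prod_X_pow_mul_Phi,
      ← sideProd_gExp _ _ hi.1 hi.2 hk.1 hk.2, ← sideProd_gExp _ _ hk.1 hk.2 hi.1 hi.2]
  have hq : q = 0 ↔ a = 0 ∧ b = 0 := by
    constructor
    · rintro rfl
      exact ⟨rfl, rfl⟩
    · rintro ⟨ha, hb⟩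
      ext v
      rcases v with v | v
      · exact congrFun ha v
      · exact congrFun hb v
  rw [map_sub]
  simp only [map_sum]
  rw [Finset.sum_congr rfl fun i hi => Finset.sum_congr rfl fun k hk => hf i hi k hk,
    Finset.sum_congr rfl fun i hi => Finset.sum_congr rfl fun k hk => hg i hi k hk,
    ← Finset.sum_mul_sum, ← Finset.sum_mul_sum, MvPowerSeries.coeff_one]
  rcases side_dichotomy hr a b with ⟨h, D, h1, h2⟩ | ⟨⟨h, ha⟩, h1, h2⟩ <;>
  rcases side_dichotomy hr' b a with ⟨h', D', h1', h2'⟩ | ⟨⟨h', hb⟩, h1', h2'⟩ <;>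
  rw [h1, h2, h1', h2']
  · rw [if_neg fun hq0 => h ?_]
    · ring
    · obtain ⟨ha, hb⟩ := hq.1 hq0
      simp [ha, hb]
  · rw [if_neg fun hq0 => h ?_, hb]
    · simp
    · obtain ⟨ha, hb⟩ := hq.1 hq0
      simp [ha, hb]
  · rw [if_neg fun hq0 => h' ?_, ha]
    · simp
    · obtain ⟨ha, hb⟩ := hq.1 hq0
      simp [ha, hb]
  · rw [if_pos (hq.2 ⟨ha, hb⟩)]
    ring

/-! ### Solutions of the system -/

section Solutions

variable {ι : Half n → V} {u : Fin n → MvPowerSeries V ℂ} {u' : Fin n' → MvPowerSeries V ℂ}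

lemma constantCoeff_uExt (h : SideEq ι u u') {j : ℕ} (hj : j ≤ n) :
    MvPowerSeries.constantCoeff (uExt u j) = 1 := by
  induction j with
  | zero => exact map_one _
  | succ j ih =>
    simpa [constantCoeff_zVar, ih (by omega)] using
      congrArg MvPowerSeries.constantCoeff (h ⟨j, hj⟩)

lemma constantCoeff_eq_one (h : SideEq ι u u') (i : Fin n) :
    MvPowerSeries.constantCoeff (u i) = 1 := by
  have := constantCoeff_uExt h (Nat.succ_le_of_lt i.2)
  rwa [uExt, dif_pos i.2] at this

lemma constantCoeff_sideEta (v : Half n) :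
    MvPowerSeries.constantCoeff (sideEta ι u u' v) = 0 := by
  rcases v with v | v | v <;> simp [sideEta]

variable {φ : MvPowerSeries V ℂ →+* MvPowerSeries V ℂ}

lemma map_zVar_mul (hφ : ∀ v, φ (MvPowerSeries.X (ι v)) = sideEta ι u u' v)
    (h : SideEq ι u u') {j : ℕ} (hj : j < n) :
    φ (zVar ι j) * uExt u j = zVar ι j * uExt u (j + 2) := by
  unfold zVar
  split_ifs with hj'
  · rw [hφ, sideEta, mul_assoc, MvPowerSeries.inv_mul_cancel, mul_one]
    rw [constantCoeff_uExt h hj.le]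
    exact one_ne_zero
  · rw [map_zero, zero_mul, zero_mul]

/-- Substituting η into (1 + s_j + t_j) U_j = 1 + w_j and multiplying by u_j gives the j-th equation
of the system, so U_j(η) = u_{j+1}/u_j. -/
lemma map_siteUnit_mul (hφ : ∀ v, φ (MvPowerSeries.X (ι v)) = sideEta ι u u' v)
    (h : SideEq ι u u') {j : ℕ} (hj : j < n) :
    φ (siteUnit ι j) * uExt u j = uExt u (j + 1) := by
  refine ((isUnit_siteDen ι ⟨j, hj⟩).map φ).mul_left_cancel ?_
  have h1 : φ (siteDen ι ⟨j, hj⟩) * φ (siteUnit ι j) = 1 + φ (zVar ι j) := by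
    rw [← map_mul, siteDen_mul_siteUnit ι ⟨j, hj⟩, map_add, map_one]
  rw [← mul_assoc, h1, add_mul, one_mul, map_zVar_mul hφ h hj, siteDen, map_add, map_add, map_one,
    hφ, hφ, sideEta, sideEta]
  have := h ⟨j, hj⟩
  simp only at this
  linear_combination -this

lemma map_siteUnit_zero (hφ : ∀ v, φ (MvPowerSeries.X (ι v)) = sideEta ι u u' v)
    (h : SideEq ι u u') (hn : 1 ≤ n) : φ (siteUnit ι 0) = uExt u 1 := by
  have := map_siteUnit_mul hφ h (j := 0) hn
  rwa [uExt, mul_one] at this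

lemma sideEta_eq {ι' : Half n' → V} (hφ : ∀ v, φ (MvPowerSeries.X (ι v)) = sideEta ι u u' v)
    (hφ' : ∀ v, φ (MvPowerSeries.X (ι' v)) = sideEta ι' u' u v)
    (h : SideEq ι u u') (h' : SideEq ι' u' u) (hn : 1 ≤ n) (hn' : 1 ≤ n') (v : Half n) :
    sideEta ι u u' v = MvPowerSeries.X (ι v) * φ (sidePsi ι ι' v) := by
  rcases v with v | v | v
  · rw [sideEta, sidePsi, map_siteUnit_zero hφ h hn]
  · rw [sideEta, sidePsi, map_siteUnit_zero hφ' h' hn']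
  · have hv : (v : ℕ) + 1 < n := by omega
    rw [sideEta, sidePsi, mul_assoc]
    congr 1
    rw [← map_siteUnit_mul hφ h hv, ← map_siteUnit_mul hφ h (show (v : ℕ) < n by omega), mul_assoc,
      mul_assoc, MvPowerSeries.mul_inv_cancel, mul_one, Units.val_mul, map_mul, mul_comm]
    rw [constantCoeff_uExt h (by omega)]
    exact one_ne_zero

end Solutions

/-! ### Lagrange inversion by comparison of two linear maps -/

/-- Substitution of the series `η` for the variables. -/
lemma exists_algHom_X_eq_eta (u : Fin r → PS r r') (u' : Fin r' → PS r r') :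
    ∃ φ : PS r r' →ₐ[ℂ] PS r r', ∀ v, φ (MvPowerSeries.X v) = eta u u' v := by
  have hs : MvPowerSeries.HasSubst (eta u u') := by
    refine MvPowerSeries.hasSubst_of_constantCoeff_zero fun v => ?_
    rcases v with v | v <;> exact constantCoeff_sideEta v
  exact ⟨MvPowerSeries.substAlgHom hs, MvPowerSeries.substAlgHom_X hs⟩

/-- The Lagrange inversion formula for the system. -/
lemma laurentMonomial_eta (hr : 1 ≤ r) (hr' : 1 ≤ r') {u : Fin r → PS r r'}
    {u' : Fin r' → PS r r'} (h : IsSolution u u') (q : Var r r' → ℤ) :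
    laurentMonomial (eta u u') q = laurentMonomial (fun v => MvPowerSeries.X v) q *
      algebraMap (PS r r') (Frac r r')
        (rhsMap r r' ((∏ v, psi v ^ q v : (PS r r')ˣ) : PS r r')) := by
  obtain ⟨φ, hφ⟩ := exists_algHom_X_eq_eta u u'
  have heta : ∀ v, eta u u' v = MvPowerSeries.X v * φ (psi v) := by
    rintro (v | v)
    · exact sideEta_eq (φ := φ.toRingHom) (fun v => hφ (Sum.inl v)) (fun v => hφ (Sum.inr v))
        h.1 h.2 hr hr' v
    · exact sideEta_eq (φ := φ.toRingHom) (fun v => hφ (Sum.inr v)) (fun v => hφ (Sum.inl v))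
        h.2 h.1 hr' hr v
  have hmap : rhsMap r r' = φ.toLinearMap := by
    rw [← sub_eq_zero]
    refine linearMap_eq_zero_of_X_mul _ (fun v => psi v) ?_ fun v g => ?_
    · simp [rhsMap_one hr hr']
    · simp only [LinearMap.sub_apply, rhsMap_X_mul, AlgHom.toLinearMap_apply, map_mul, hφ, heta]
      ring
  rw [hmap, AlgHom.toLinearMap_apply]
  -- Integer powers of units are carried to the field through the induced map on unit groups.
  let θ : PS r r' →* Frac r r' :=
    ((algebraMap (PS r r') (Frac r r')).comp φ.toRingHom : PS r r' →* Frac r r')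
  have hθ : algebraMap (PS r r') (Frac r r') (φ ((∏ v, psi v ^ q v : (PS r r')ˣ) : PS r r')) =
      ∏ v, (algebraMap (PS r r') (Frac r r') (φ (psi v))) ^ q v := by
    change ((Units.map θ (∏ v, psi v ^ q v) : (Frac r r')ˣ) : Frac r r') = _
    rw [map_prod, Units.coe_prod]
    refine Finset.prod_congr rfl fun v _ => ?_
    rw [map_zpow, Units.val_zpow_eq_zpow_val]
    rfl
  rw [hθ, laurentMonomial, laurentMonomial, ← Finset.prod_mul_distrib]
  refine Finset.prod_congr rfl fun v _ => ?_
  rw [heta, map_mul, mul_zpow]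

/-! ### Existence and uniqueness of the solution -/

/-- Equality of power series up to terms of total degree at least `N`. -/
def AgreeBelow (N : ℕ) (f g : MvPowerSeries V ℂ) : Prop :=
  ∀ d : V →₀ ℕ, d.degree < N → MvPowerSeries.coeff d f = MvPowerSeries.coeff d g

namespace AgreeBelow

variable {N : ℕ} {f f' g g' : MvPowerSeries V ℂ}

lemma refl (N : ℕ) (f : MvPowerSeries V ℂ) : AgreeBelow N f f := fun _ _ => rfl

lemma add (hf : AgreeBelow N f f') (hg : AgreeBelow N g g') :
    AgreeBelow N (f + g) (f' + g') := fun d hd => by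
  rw [map_add, map_add, hf d hd, hg d hd]

lemma sub (hf : AgreeBelow N f f') (hg : AgreeBelow N g g') :
    AgreeBelow N (f - g) (f' - g') := fun d hd => by
  rw [map_sub, map_sub, hf d hd, hg d hd]

lemma sum {I : Type} (s : Finset I) {f f' : I → MvPowerSeries V ℂ}
    (h : ∀ i ∈ s, AgreeBelow N (f i) (f' i)) :
    AgreeBelow N (∑ i ∈ s, f i) (∑ i ∈ s, f' i) := fun d hd => by
  rw [map_sum, map_sum]
  exact Finset.sum_congr rfl fun i hi => h i hi d hd

lemma mul (hf : AgreeBelow N f f') (hg : AgreeBelow N g g') :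
    AgreeBelow N (f * g) (f' * g') := fun d hd => by
  classical
  rw [MvPowerSeries.coeff_mul, MvPowerSeries.coeff_mul]
  refine Finset.sum_congr rfl fun p hp => ?_
  have h : p.1.degree + p.2.degree = d.degree := by
    rw [← map_add, Finset.HasAntidiagonal.mem_antidiagonal.1 hp]
  rw [hf _ (by omega), hg _ (by omega)]

lemma X_mul (hf : AgreeBelow N f f') (v : V) :
    AgreeBelow (N + 1) (MvPowerSeries.X v * f) (MvPowerSeries.X v * f') := fun d hd => by
  classical
  rw [MvPowerSeries.X_def, MvPowerSeries.coeff_monomial_mul, MvPowerSeries.coeff_monomial_mul]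
  split_ifs with hv
  · obtain ⟨e, rfl⟩ := exists_add_of_le hv
    rw [map_add, Finsupp.degree_single] at hd
    rw [add_tsub_cancel_left, hf e (by omega)]
  · rfl

lemma mono {M : ℕ} (h : AgreeBelow N f g) (hM : M ≤ N) : AgreeBelow M f g :=
  fun d hd => h d (hd.trans_le hM)

lemma trans (h : AgreeBelow N f f') (h' : AgreeBelow N f' g) : AgreeBelow N f g :=
  fun d hd => (h d hd).trans (h' d hd)

lemma symm (h : AgreeBelow N f g) : AgreeBelow N g f := fun d hd => (h d hd).symm

lemma eq (h : ∀ N, AgreeBelow N f g) : f = g := by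
  ext d
  exact h (d.degree + 1) d (Nat.lt_succ_self _)

end AgreeBelow

/-- A map on families of power series which is contracting for the total degree has a unique
fixed point. -/
lemma existsUnique_fixedPoint {I : Type}
    (T : (I → MvPowerSeries V ℂ) → I → MvPowerSeries V ℂ)
    (hT : ∀ N U W, (∀ i, AgreeBelow N (U i) (W i)) → ∀ i, AgreeBelow (N + 1) (T U i) (T W i)) :
    ∃! U, T U = U := by
  have hzero : ∀ f g : MvPowerSeries V ℂ, AgreeBelow 0 f g := fun _ _ d hd => by omega
  have step : ∀ N i, AgreeBelow N (T^[N] 0 i) (T^[N + 1] 0 i) := by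
    intro N
    induction N with
    | zero => exact fun i => hzero _ _
    | succ N ih =>
      intro i
      rw [Function.iterate_succ_apply', Function.iterate_succ_apply' T (N + 1)]
      exact hT N _ _ ih i
  have steps : ∀ N k i, AgreeBelow N (T^[N] 0 i) (T^[N + k] 0 i) := by
    intro N k i
    induction k with
    | zero => exact AgreeBelow.refl _ _
    | succ k ih => exact ih.trans ((step (N + k) i).mono (by omega))
  -- The coefficient at d no longer changes from the iterate number d.degree + 1 on.
  let U : I → MvPowerSeries V ℂ := fun i d => MvPowerSeries.coeff d (T^[d.degree + 1] 0 i)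
  have hU : ∀ N i, AgreeBelow N (U i) (T^[N] 0 i) := by
    intro N i d hd
    have := steps (d.degree + 1) (N - (d.degree + 1)) i d (Nat.lt_succ_self _)
    rwa [Nat.add_sub_cancel' hd] at this
  refine ⟨U, ?_, fun W hW => ?_⟩
  · funext i
    refine AgreeBelow.eq fun N => ?_
    have h1 := hT N _ _ (hU N) i
    rw [← Function.iterate_succ_apply' T] at h1
    exact (h1.trans (hU (N + 1) i).symm).mono (Nat.le_succ N)
  · have h : ∀ N i, AgreeBelow N (W i) (T^[N] 0 i) := by
      intro N
      induction N with
      | zero => exact fun i => hzero _ _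
      | succ N ih =>
        intro i
        rw [Function.iterate_succ_apply', ← congrFun hW i]
        exact hT N _ _ ih i
    funext i
    exact AgreeBelow.eq fun N => (h N i).trans (hU N i).symm

/-- The difference `u_{j+1} - u_j` prescribed by the system. -/
def sideStep (ι : Half n → V) (u : Fin n → MvPowerSeries V ℂ) (u' : Fin n' → MvPowerSeries V ℂ)
    (j : ℕ) : MvPowerSeries V ℂ :=
  if h : j < n then
    zVar ι j * uExt u (j + 2) - MvPowerSeries.X (ι (ix ⟨j, h⟩)) * (uExt u 1 * uExt u (j + 1)) -
      MvPowerSeries.X (ι (iy ⟨j, h⟩)) * (uExt u' 1 * uExt u (j + 1))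
  else 0

/-- As given, the equation for u_{j+1} contains u_j without a variable in front and is not
contracting. Summing the differences from u_0 = 1 leaves only terms multiplied by a variable or by
z_{n-1} = 0. -/
lemma sideEq_iff (ι : Half n → V) (u : Fin n → MvPowerSeries V ℂ)
    (u' : Fin n' → MvPowerSeries V ℂ) :
    SideEq ι u u' ↔
      (fun j : Fin n => 1 + ∑ i ∈ Finset.range (j + 1), sideStep ι u u' i) = u := by
  have hstep : ∀ j : Fin n, uExt u (j + 1) = uExt u j + sideStep ι u u' j ↔
      uExt u (j + 1) = uExt u j
      - MvPowerSeries.X (ι (ix j)) * uExt u 1 * uExt u (j + 1)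
      - MvPowerSeries.X (ι (iy j)) * uExt u' 1 * uExt u (j + 1)
      + zVar ι j * uExt u (j + 2) := by
    intro j
    rw [sideStep, dif_pos j.2]
    ring_nf
  have hsucc : ∀ j : Fin n, uExt u (j + 1) = u j := fun j => dif_pos j.2
  rw [SideEq, ← forall_congr' hstep, funext_iff]
  constructor
  · intro h
    have : ∀ j ≤ n, 1 + ∑ i ∈ Finset.range j, sideStep ι u u' i = uExt u j := by
      intro j hj
      induction j with
      | zero => simp [uExt]
      | succ j ih =>
        rw [Finset.sum_range_succ, ← add_assoc, ih (by omega)]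
        exact (h ⟨j, hj⟩).symm
    intro j
    rw [this _ j.2, hsucc]
  · intro h j
    have hj : 1 + ∑ i ∈ Finset.range j, sideStep ι u u' i = uExt u j := by
      obtain ⟨j, hj⟩ := j
      cases j with
      | zero => simp [uExt]
      | succ j => exact (h ⟨j, by omega⟩).trans (hsucc ⟨j, by omega⟩).symm
    rw [hsucc, ← h j, Finset.sum_range_succ, ← add_assoc, hj]

lemma agreeBelow_uExt {N : ℕ} {u w : Fin n → MvPowerSeries V ℂ}
    (h : ∀ i, AgreeBelow N (u i) (w i)) (j : ℕ) : AgreeBelow N (uExt u j) (uExt w j) := by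
  cases j with
  | zero => exact AgreeBelow.refl _ _
  | succ j =>
    simp only [uExt]
    split_ifs
    · exact h _
    · exact AgreeBelow.refl _ _

lemma agreeBelow_sideStep {N : ℕ} (ι : Half n → V) {u w : Fin n → MvPowerSeries V ℂ}
    {u' w' : Fin n' → MvPowerSeries V ℂ} (h : ∀ i, AgreeBelow N (u i) (w i))
    (h' : ∀ i, AgreeBelow N (u' i) (w' i)) (j : ℕ) :
    AgreeBelow (N + 1) (sideStep ι u u' j) (sideStep ι w w' j) := by
  have hu := agreeBelow_uExt h
  unfold sideStep
  split_ifs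
  · refine (AgreeBelow.sub ?_ (((hu 1).mul (hu _)).X_mul _)).sub
      (((agreeBelow_uExt h' 1).mul (hu _)).X_mul _)
    unfold zVar
    split_ifs
    · exact (hu _).X_mul _
    · rw [zero_mul, zero_mul]
      exact AgreeBelow.refl _ _
  · exact AgreeBelow.refl _ _

lemma existsUnique_isSolution (r r' : ℕ) :
    ∃! U : (Fin r → PS r r') × (Fin r' → PS r r'), IsSolution U.1 U.2 := by
  let T : (Fin r ⊕ Fin r' → PS r r') → Fin r ⊕ Fin r' → PS r r' := fun U => Sum.elim
    (fun j => 1 + ∑ i ∈ Finset.range (j + 1), sideStep Sum.inl (U ∘ Sum.inl) (U ∘ Sum.inr) i)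
    (fun j => 1 + ∑ i ∈ Finset.range (j + 1), sideStep Sum.inr (U ∘ Sum.inr) (U ∘ Sum.inl) i)
  have hT : ∃! U, T U = U := by
    refine existsUnique_fixedPoint T fun N U W h => ?_
    rintro (j | j) <;>
    exact (AgreeBelow.refl _ _).add (AgreeBelow.sum _ fun i _ =>
      agreeBelow_sideStep _ (fun _ => h _) (fun _ => h _) i)
  have hiff : ∀ U, T U = U ↔ IsSolution (U ∘ Sum.inl) (U ∘ Sum.inr) := by
    intro U
    rw [IsSolution, sideEq_iff, sideEq_iff]
    constructor
    · exact fun h => ⟨congrArg (· ∘ Sum.inl) h, congrArg (· ∘ Sum.inr) h⟩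
    · rintro ⟨h1, h2⟩
      funext v
      rcases v with v | v
      · exact congrFun h1 v
      · exact congrFun h2 v
  obtain ⟨U, hU, huniq⟩ := hT
  refine ⟨(U ∘ Sum.inl, U ∘ Sum.inr), (hiff U).1 hU, fun W hW => ?_⟩
  have := huniq (Sum.elim W.1 W.2) ((hiff _).2 hW)
  rw [← this]
  rfl

end JacobiPhi

end

theorem theorem5 (r r' : ℕ) (hr : 1 ≤ r) (hr' : 1 ≤ r') :
    (∃! U : (Fin r → JacobiPhi.PS r r') × (Fin r' → JacobiPhi.PS r r'),
      JacobiPhi.IsSolution U.1 U.2) ∧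
    ∀ (u : Fin r → JacobiPhi.PS r r') (u' : Fin r' → JacobiPhi.PS r r'),
      JacobiPhi.IsSolution u u' →
      (∀ i, MvPowerSeries.constantCoeff (u i) = 1) ∧
      (∀ i, MvPowerSeries.constantCoeff (u' i) = 1) ∧
      ∀ q' : JacobiPhi.Var r r' → ℤ,
        JacobiPhi.laurentMonomial (JacobiPhi.eta u u') q' =
          JacobiPhi.laurentMonomial (fun v => MvPowerSeries.X v) q' *
            algebraMap (JacobiPhi.PS r r') (JacobiPhi.Frac r r')
              ((∑ i ∈ Finset.Icc (-1 : ℤ) ((r : ℤ) - 1),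
                  ∑ k ∈ Finset.Icc (-1 : ℤ) ((r' : ℤ) - 1),
                    JacobiPhi.fMon Sum.inl i * JacobiPhi.fMon Sum.inr k
                      * JacobiPhi.shiftedPhi q' i k)
                - (∑ i ∈ Finset.Icc (0 : ℤ) ((r : ℤ) - 1),
                  ∑ k ∈ Finset.Icc (0 : ℤ) ((r' : ℤ) - 1),
                    JacobiPhi.gMon Sum.inl i * JacobiPhi.gMon Sum.inr k
                      * JacobiPhi.shiftedPhi q' i k)) := by
  refine ⟨JacobiPhi.existsUnique_isSolution r r', fun u u' h =>
    ⟨JacobiPhi.constantCoeff_eq_one h.1, JacobiPhi.constantCoeff_eq_one h.2, fun q' => ?_⟩⟩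
  rw [JacobiPhi.laurentMonomial_eta hr hr' h, JacobiPhi.prod_psi hr hr',
    JacobiPhi.rhsMap_sidePow hr hr']
  rfl
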